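/- **Setting.** Let $T>0$, $\beta>0$, and let $p:\mathbb R\to\mathbb R$ be a continuous integrable pulse. Put $g(t)=\int p(s)\,p(s-t)\,ds$ and let $G$ be the Fourier transform of $g$. Assume that $g(nT)=0$ for all integers $n\neq 0$, that $g(0)=1$, and that $G(f)\neq 0$ exactly when $|f|<\frac{1+\beta}{2T}$. Let $0<\delta<\frac1{1+\beta}$ be the acceleration factor of faster-than-Nyquist signaling, i.e. symbols are sent every $\delta T$ seconds. Let $h\ne0$ be the coefficient of the frequency-flat channel, $\sigma_0^2>0$ the noise power spectral density, $P$ the transmit power of the antenna and $E=P\delta T$ the symbol energy. Fixed received SNR means that $SNR_{rx}=\frac{P\delta}{\sigma_0^2}=\frac{E/T}{\sigma_0^2}$ does not depend on $\delta$; hence $E>0$ is fixed and $P=P(\delta)=\frac{E}{\delta T}$. *Optimal power allocation.* Let $\mathcal G_\delta(f)=\sum_{k\in\mathbb Z}g(k\delta T)e^{2\pi i fk}$. An input spectrum $S\ge 0$ on $[-\frac12,\frac12]$ is admissible if $S\,\mathcal G_\delta$ is integrable and $\frac1{\delta T}\int_{-1/2}^{1/2}S\,\mathcal G_\delta\,df\le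 P$. It is optimal if it maximizes the information rate $\int_{-1/2}^{1/2}\log_2\!\big(1+\frac{|h|^2S\,\mathcal G_\delta}{\sigma_0^2}\big)df$ among all admissible spectra, vanishes where $\mathcal G_\delta=0$, and is continuous on $\{\mathcal G_\delta\neq0\}$. *Signal.* For $N=2M+1$, let $\boldsymbol D=\big(\frac1{\sqrt N}e^{-2\pi i mn/N}\big)_{m,n=-M}^{M}$. Let the symbols $(a[m])_{|m|\le M}$ be centered circularly symmetric complex Gaussian with covariance matrix $\boldsymbol\Sigma=\boldsymbol D\,\mathrm{diag}(S(i/N))_{|i|\le M}\,\boldsymbol D^\dagger$, where $S$ is optimal. The transmitted signal in its cyclostationary form is $x(t)=\sum_{m\in\mathbb Z}a[m]\,p(t-m\delta T)$ with $a$ continued $N$-periodically. Its average CCDF (complementary cumulative distribution function of the instantaneous power, averaged over one period; called the average CCDF of the PAPR) is $$\bar{\mathcal C}_N(\gamma)=\frac1{\delta T}\int_0^{\delta T}\Pr\big[|x(t)|^2\ge\gamma\big]\,dt .$$ **Statement.** For every $0<\delta<\frac{1}{1+\beta}$, the spectrum equal to $P\delta T\cdot\frac{T}{(1+\beta)\,G(f/(\delta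 T))}$ for $|f|<\frac{\delta(1+\beta)}2$ and to $0$ for all other $f\in[-\frac12,\frac12]$ is optimal. For every optimal allocation and every $\gamma\ge0$, $$\bar{\mathcal C}(\gamma):=\lim_{N\to\infty}\bar{\mathcal C}_N(\gamma)=\exp\!\Big(-\frac{\gamma\,\delta\,T}{E}\Big),\qquad 0<\delta<\frac1{1+\beta},$$ and $\bar{\mathcal C}(\gamma)\to1$ as $\delta\to0^+$. Thus the power at the transmitter becomes unbounded: for all real $\gamma$ and all $\eta<1$, for all sufficiently small $\delta>0$ one has $\bar{\mathcal C}_N(\gamma)>\eta$ for all sufficiently large $N$. -/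

import Mathlib

open MeasureTheory ProbabilityTheory Filter Topology
open scoped FourierTransform Matrix

noncomputable section

namespace FTN

/-- Matched filter response `g(t) = p(t) ⋆ p(-t)` of a real pulse `p`. -/
def matchedFilter (p : ℝ → ℝ) (t : ℝ) : ℝ := ∫ s, p s * p (s - t)

/-- Energy spectrum `G(f)` of the pulse: the continuous-time Fourier transform of the matched filter
response (it is real valued, because the response is even). -/
def energySpectrum (p : ℝ → ℝ) (f : ℝ) : ℝ :=
  (𝓕 (fun t : ℝ => (matchedFilter p t : ℂ)) f).re

/-- Pulse-shaping filters: continuous integrable real pulses `p` that cause no intersymbol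
interference at the symbol period `T` (root Nyquist property) and whose energy spectrum has roll-off
factor `β`, i.e. is supported by the band `|f| ≤ (1 + β) / (2 T)` and vanishes nowhere inside it. -/
structure IsPulse (p : ℝ → ℝ) (T β : ℝ) : Prop where
  continuous : Continuous p
  integrable : Integrable p
  nyquist : ∀ n : ℤ, matchedFilter p (n * T) = if n = 0 then 1 else 0
  band : ∀ f : ℝ, energySpectrum p f ≠ 0 ↔ |f| < (1 + β) / (2 * T)

/-- Generating function `∑ₖ g(k h) exp(2 π i f k)` of the Toeplitz matrix `(g((n - m) h))ₙₘ` of the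
sampled matched filter output, for the symbol spacing `h = δ T`. -/
def generatingFunction (p : ℝ → ℝ) (h f : ℝ) : ℝ :=
  (∑' k : ℤ, (matchedFilter p (k * h) : ℂ) * Complex.exp (2 * Real.pi * Complex.I * f * k)).re

/-- Received signal-to-noise ratio `P δ / σ₀²`; here `P` is the transmit power and `σ₀²` the power
spectral density of the noise. The symbol energy is `E = P δ T`, so this is `(E / T) / σ₀²`. -/
def receivedSNR (P δ σ₀ : ℝ) : ℝ := P * δ / σ₀ ^ 2

/-- Average transmit power of the signal with symbol spacing `h` whose symbols have spectrum `S`. -/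
def spectralPower (p : ℝ → ℝ) (h : ℝ) (S : ℝ → ℝ) : ℝ :=
  1 / h * ∫ f in Set.Icc (-(1 / 2) : ℝ) (1 / 2), S f * generatingFunction p h f

/-- Information rate, in bits per symbol, of Gaussian signaling with symbol spectrum `S` over the
frequency-flat channel with coefficient `c`, noise level `σ₀²` and symbol spacing `h`. -/
def informationRate (p : ℝ → ℝ) (h : ℝ) (c : ℂ) (σ₀ : ℝ) (S : ℝ → ℝ) : ℝ :=
  ∫ f in Set.Icc (-(1 / 2) : ℝ) (1 / 2),
    Real.logb 2 (1 + ‖c‖ ^ 2 * (S f * generatingFunction p h f) / σ₀ ^ 2)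

/-- Input spectra on `[-1/2, 1/2]` that use at most the transmit power `P`. -/
structure IsAdmissible (p : ℝ → ℝ) (h P : ℝ) (S : ℝ → ℝ) : Prop where
  nonneg : ∀ f ∈ Set.Icc (-(1 / 2) : ℝ) (1 / 2), 0 ≤ S f
  integrable : IntegrableOn (fun f => S f * generatingFunction p h f)
    (Set.Icc (-(1 / 2) : ℝ) (1 / 2))
  power : spectralPower p h S ≤ P

/-- Optimal power allocation over frequency: an admissible input spectrum that maximizes the
information rate. As the spectrum is going to be sampled, the representative is normalized: it
vanishes at the frequencies where the pulse has no energy, and it is continuous on the others. -/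
structure IsOptimal (p : ℝ → ℝ) (h : ℝ) (c : ℂ) (σ₀ P : ℝ) (S : ℝ → ℝ) : Prop where
  admissible : IsAdmissible p h P S
  maximal : ∀ S' : ℝ → ℝ, IsAdmissible p h P S' →
    informationRate p h c σ₀ S' ≤ informationRate p h c σ₀ S
  continuousOn : ContinuousOn S
    {f | f ∈ Set.Icc (-(1 / 2) : ℝ) (1 / 2) ∧ generatingFunction p h f ≠ 0}
  vanishing : ∀ f ∈ Set.Icc (-(1 / 2) : ℝ) (1 / 2), generatingFunction p h f = 0 → S f = 0

/-- The spectrum `P δ T φ(f)` with `φ(f) = T / ((1 + β) G(f / (δ T)))` for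
`|f| < δ (1 + β) / 2` and `φ(f) = 0` otherwise. -/
def inverseSpectrum (p : ℝ → ℝ) (T β δ P f : ℝ) : ℝ :=
  if |f| < δ * (1 + β) / 2 then
    P * (δ * T) * (T / ((1 + β) * energySpectrum p (f / (δ * T))))
  else 0

/-- The unitary DFT matrix of odd size `N = 2 M + 1`. The index set `ℤ/N` is represented by
`-M, …, M`, which are the values of `ZMod.valMinAbs`. -/
def dftMatrix (M : ℕ) : Matrix (ZMod (2 * M + 1)) (ZMod (2 * M + 1)) ℂ := fun m n =>
  (1 / Real.sqrt ((2 * M + 1 : ℕ) : ℝ) : ℂ) *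
    Complex.exp (-(2 * Real.pi * Complex.I * (m.valMinAbs : ℂ) * (n.valMinAbs : ℂ)
      / ((2 * M + 1 : ℕ) : ℂ)))

/-- Input covariance matrix `Σ = D diag(S(i / N)) Dᴴ`, where `i = -M, …, M`: the spectrum `S` is
evenly sampled `N = 2 M + 1` times in `[-1/2, 1/2]`. -/
def inputCovariance (M : ℕ) (S : ℝ → ℝ) : Matrix (ZMod (2 * M + 1)) (ZMod (2 * M + 1)) ℂ :=
  dftMatrix M *
    Matrix.diagonal (fun i => ((S ((i.valMinAbs : ℝ) / ((2 * M + 1 : ℕ) : ℝ)) : ℝ) : ℂ)) *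
    (dftMatrix M)ᴴ

/-- `a ∼ 𝒞𝒩(0, C)`: the vector `a` is centered circularly symmetric complex Gaussian with covariance
matrix `C`. -/
structure IsCircularGaussian {ι Ω : Type*} [Fintype ι] [MeasurableSpace Ω]
    (a : ι → Ω → ℂ) (C : Matrix ι ι ℂ) (μ : Measure Ω) : Prop where
  gaussian : HasGaussianLaw (fun ω i => a i ω) μ
  mean : ∀ i, ∫ ω, a i ω ∂μ = 0
  covariance : ∀ i j, ∫ ω, a i ω * (starRingEnd ℂ) (a j ω) ∂μ = C i j
  pseudoCovariance : ∀ i j, ∫ ω, a i ω * a j ω ∂μ = 0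

/-- The transmitted signal `x(t) = ∑ₘ a[m] p(t - m h)`, with symbols sent every `h = δ T`
seconds. The block of symbols `a[-M], …, a[M]` is continued periodically over all integers `m`. For a
covariance matrix that is diagonalized by the DFT the symbol sequence is then stationary, so that
the signal is cyclostationary with period `h`. -/
def signal {Ω : Type*} (p : ℝ → ℝ) (h : ℝ) (M : ℕ) (a : ZMod (2 * M + 1) → Ω → ℂ)
    (t : ℝ) (ω : Ω) : ℂ :=
  ∑' m : ℤ, a (m : ZMod (2 * M + 1)) ω * (p (t - m * h) : ℂ)

/-- CCDF of the instantaneous power at time `t`: `Pr[|x(t)|² ≥ γ]`. -/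
def ccdf {Ω : Type*} [MeasurableSpace Ω] (μ : Measure Ω) (x : ℝ → Ω → ℂ) (γ t : ℝ) : ℝ :=
  μ.real {ω | γ ≤ ‖x t ω‖ ^ 2}

/-- Average CCDF over one period `[0, h]`, where `h = δ T`. -/
def averageCCDF {Ω : Type*} [MeasurableSpace Ω] (μ : Measure Ω) (x : ℝ → Ω → ℂ)
    (h γ : ℝ) : ℝ :=
  1 / h * ∫ t in (0 : ℝ)..h, ccdf μ x γ t

end FTN

end

/-! For `δ < 1 / (1 + β)` the symbol spacing `h = δ T` is short enough that sampling the pulse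
causes no aliasing. Poisson summation (`hasSum_samples`) then shows that the discrete-time spectrum
of `m ↦ p (t - m h)` is a single rescaled copy of the Fourier transform of `p`, and that `t` enters
only through a factor of modulus one. Its squared modulus is `𝒢(ν) / h` for every `t`, where `𝒢 =
G(· / h) / h` is the generating function.

Both power and rate depend on `S` only through `S 𝒢`, which lives on a band of width `δ (1 + β)`.
Since `y ↦ log (1 + κ y)` is strictly concave, the rate is maximal exactly when `S 𝒢` equals `P T /
(1 + β)` almost everywhere on the band; continuity makes this hold at every point
(`mul_eq_of_isOptimal`), so it applies to the sampled spectrum.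

At each time `x(t)` is a finite linear combination of the symbols, hence centered circularly
symmetric Gaussian. Diagonalizing the covariance by the DFT gives its variance `(N h)⁻¹ ∑ₖ (S 𝒢)(k /
N)`, which is `P / (δ (1 + β))` times the proportion of grid frequencies in the band. So `|x(t)|²`
is exponential with this mean (`ccdf_signal`). The proportion tends to `δ (1 + β)`, the mean to `P =
E / (δ T)`, and the tail to `exp (-γ δ T / E)`, which tends to `1` as `δ → 0⁺`. -/

namespace FTN

/-! ### Fourier inversion and sampling of band-limited functions -/

/-- A continuous function that vanishes outside a bounded interval is integrable. -/
lemma integrable_of_continuous_of_vanishing {F : ℝ → ℂ} {B : ℝ} (hF : Continuous F)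
    (hB : ∀ ξ, B ≤ |ξ| → F ξ = 0) : Integrable F := by
  refine hF.integrable_of_hasCompactSupport
    (HasCompactSupport.intro (K := Set.Icc (-B) B) isCompact_Icc fun x hx => hB x ?_)
  by_contra! h
  exact hx ⟨(abs_lt.1 h).1.le, (abs_lt.1 h).2.le⟩

lemma continuous_fourier {q : ℝ → ℂ} (hq : Integrable q) : Continuous (𝓕 q) :=
  VectorFourier.fourierIntegral_continuous Real.continuous_fourierChar
    (by exact continuous_inner) hq

/-- Fourier inversion for continuous integrable band-limited functions. -/
lemma eq_integral_of_bandlimited {q : ℝ → ℂ} {B : ℝ} (hq : Continuous q) (hqi : Integrable q)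
    (hB : ∀ ξ, B ≤ |ξ| → 𝓕 q ξ = 0) (x : ℝ) :
    q x = ∫ ξ : ℝ, Complex.exp (2 * Real.pi * Complex.I * ξ * x) * 𝓕 q ξ := by
  have hF := integrable_of_continuous_of_vanishing (continuous_fourier hqi) hB
  have h := congrFun (hq.fourierInv_fourier_eq hqi hF) x
  rw [← h, Real.fourierInv_eq']
  congr 1
  ext ξ
  simp only [RCLike.inner_apply, conj_trivial, smul_eq_mul]
  congr 2
  push_cast
  ring

/-- A band-limited integrable function is reproduced by a kernel with quadratic decay. -/
lemma exists_kernel_bound {q : ℝ → ℂ} {B : ℝ} (hq : Continuous q) (hqi : Integrable q)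
    (hB : ∀ ξ, B ≤ |ξ| → 𝓕 q ξ = 0) :
    ∃ C : ℝ, 0 ≤ C ∧ ∀ x, ‖q x‖ ≤ ∫ s, ‖q s‖ * (C / (1 + (s - x) ^ 2)) := by
  -- A smooth cutoff equal to `1` on the band leaves `𝓕 q` unchanged under multiplication, so `q` is
  -- reproduced by the rapidly decaying kernel `𝓕 χ`. The radii use `|B|` because `B` has no sign
  -- assumption.
  obtain ⟨χ, hχ⟩ : ∃ χ : SchwartzMap ℝ ℂ, ∀ ξ, |ξ| < B → χ ξ = 1 := by
    let b : ContDiffBump (0 : ℝ) := ⟨|B| + 1, |B| + 2, by positivity, by linarith⟩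
    have h1 : HasCompactSupport (fun x => ((b x : ℝ) : ℂ)) :=
      b.hasCompactSupport.comp_left (g := fun x : ℝ => (x : ℂ)) (by simp)
    have h2 : ContDiff ℝ (⊤ : ℕ∞) (fun x => ((b x : ℝ) : ℂ)) :=
      Complex.ofRealCLM.contDiff.comp b.contDiff
    refine ⟨h1.toSchwartzMap h2, fun ξ hξ => ?_⟩
    have : b ξ = 1 := b.one_of_mem_closedBall (by
      simp only [Metric.mem_closedBall, dist_zero_right, Real.norm_eq_abs]
      change |ξ| ≤ |B| + 1
      have := le_abs_self B
      linarith)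
    simp [this]
  obtain ⟨C0, hC0⟩ := (𝓕 χ).decay 0 0
  obtain ⟨C2, hC2⟩ := (𝓕 χ).decay 2 0
  have hφ : ∀ x, ‖𝓕 (χ : ℝ → ℂ) x‖ ≤ (C0 + C2) / (1 + x ^ 2) := by
    intro x
    have h0 := hC0.2 x
    have h2 := hC2.2 x
    simp only [pow_zero, one_mul, norm_iteratedFDeriv_zero, SchwartzMap.fourier_coe,
      Real.norm_eq_abs, sq_abs] at h0 h2
    rw [le_div_iff₀ (by positivity)]
    nlinarith
  refine ⟨C0 + C2, by linarith [hC0.1, hC2.1], fun x => ?_⟩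
  have hψ : Integrable (fun ξ : ℝ => Complex.exp (2 * Real.pi * Complex.I * ξ * x) * χ ξ) := by
    refine χ.integrable.bdd_mul (c := 1) (by fun_prop) (ae_of_all _ fun ξ => ?_)
    rw [show (2 * Real.pi * Complex.I * ξ * x : ℂ) = ((2 * Real.pi * ξ * x : ℝ) : ℂ) * Complex.I by
      push_cast; ring, Complex.norm_exp_ofReal_mul_I]
  -- The multiplication formula moves the Fourier transform from `q` to the modulated cutoff, whose
  -- transform at `s` is `𝓕 χ (s - x)`.
  have key : q x = ∫ s, q s * 𝓕 (χ : ℝ → ℂ) (s - x) := by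
    rw [eq_integral_of_bandlimited hq hqi hB x]
    have h := VectorFourier.integral_fourierIntegral_smul_eq_flip (e := Real.fourierChar)
      (μ := volume) (ν := volume) (L := innerₗ ℝ)
      Real.continuous_fourierChar continuous_inner hqi hψ
    have e1 : ∀ ξ, VectorFourier.fourierIntegral Real.fourierChar volume (innerₗ ℝ) q ξ = 𝓕 q ξ :=
      fun _ => rfl
    simp only [e1, smul_eq_mul] at h
    calc _ = ∫ ξ, 𝓕 q ξ * (Complex.exp (2 * Real.pi * Complex.I * ξ * x) * χ ξ) := by
          congr 1
          ext ξ
          rcases lt_or_ge |ξ| B with h | h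
          · rw [hχ ξ h]; ring
          · rw [hB ξ h]; ring
      _ = _ := by
          rw [h]
          congr 1
          ext s
          congr 1
          rw [VectorFourier.fourierIntegral, Real.fourier_real_eq]
          refine integral_congr_ae (ae_of_all _ fun v => ?_)
          simp only [Circle.smul_def, Real.fourierChar_apply, smul_eq_mul, ← mul_assoc,
            ← Complex.exp_add, LinearMap.flip_apply, innerₗ_apply_apply, RCLike.inner_apply,
            conj_trivial]
          congr 2
          push_cast
          ring
  rw [key]
  refine (norm_integral_le_integral_norm _).trans (integral_mono_of_nonneg
    (ae_of_all _ fun _ => norm_nonneg _) ?_ (ae_of_all _ fun s => ?_))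
  · refine hqi.norm.mul_bdd (c := C0 + C2) ?_ (ae_of_all _ fun s => ?_)
    · refine Continuous.aestronglyMeasurable (continuous_const.div (by fun_prop) fun s => ?_)
      positivity
    · have : 0 ≤ C0 + C2 := by linarith [hC0.1, hC2.1]
      rw [Real.norm_of_nonneg (by positivity)]
      exact div_le_self this (by nlinarith [sq_nonneg (s - x)])
  · simp only [norm_mul]
    gcongr
    exact hφ _

/-- Sampled sums of the kernel `1 / (1 + x²)` are bounded uniformly in the sampling phase. -/
lemma exists_sum_kernel_le {h : ℝ} (hh : 0 < h) :
    ∃ K : ℝ, ∀ (x : ℝ) (s : Finset ℤ), ∑ m ∈ s, 1 / (1 + (x + m * h) ^ 2) ≤ K := by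
  -- The majorant does not involve the phase `x`. At `m = 0` the first summand is `0`, as division
  -- by zero gives zero, so the second one supplies the bound `1` there.
  have hs : Summable (fun m : ℤ => (2 + 2 / h ^ 2) * (1 / ((m : ℝ) ^ 2)) + (if m = 0 then 1 else 0)) := by
    refine Summable.add ((Real.summable_one_div_int_pow.2 one_lt_two).mul_left _) ?_
    exact summable_of_hasFiniteSupport ((Set.finite_singleton (0 : ℤ)).subset fun m hm => by
      by_contra h0
      simp at h0
      simp [h0] at hm)
  refine ⟨∑' m : ℤ, ((2 + 2 / h ^ 2) * (1 / ((m : ℝ) ^ 2)) + (if m = 0 then 1 else 0)), fun x s => ?_⟩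
  -- Shifting the index by `n` reduces the phase to `θ ∈ [0, 1)`; then `k² ≤ 2 (k + θ)² + 2`
  -- accounts for the constant `2 + 2 / h²`.
  set n : ℤ := ⌊x / h⌋ with hn
  set θ := Int.fract (x / h) with hθ
  have hx : x = h * (n + θ) := by
    rw [hn, hθ, Int.floor_add_fract]
    field_simp
  have hθ0 : 0 ≤ θ := Int.fract_nonneg _
  have hθ1 : θ < 1 := Int.fract_lt_one _
  have hle : ∀ m : ℤ, 1 / (1 + (x + m * h) ^ 2) ≤
      (2 + 2 / h ^ 2) * (1 / (((m + n : ℤ) : ℝ) ^ 2)) + (if m + n = 0 then 1 else 0) := by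
    intro m
    have e : x + m * h = h * (((m + n : ℤ) : ℝ) + θ) := by rw [hx]; push_cast; ring
    rw [e]
    generalize m + n = k
    split_ifs with hk
    · subst hk
      simp only [Int.cast_zero, zero_add]
      norm_num
      rw [inv_le_one₀ (by positivity)]
      nlinarith [sq_nonneg (h * θ)]
    · have hk2 : (1 : ℝ) ≤ (k : ℝ) ^ 2 := by
        have : (1 : ℤ) ≤ k ^ 2 := by have := sq_pos_of_ne_zero hk; omega
        exact_mod_cast this
      rw [add_zero, div_le_iff₀ (by positivity)]
      have h1 : (k : ℝ) ^ 2 ≤ 2 * ((k : ℝ) + θ) ^ 2 + 2 := by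
        nlinarith [sq_nonneg ((k : ℝ) + 2 * θ)]
      have h2 : (k : ℝ) ^ 2 ≤ (2 + 2 / h ^ 2) * (1 + (h * ((k : ℝ) + θ)) ^ 2) := by
        have : (2 + 2 / h ^ 2) * (1 + (h * ((k : ℝ) + θ)) ^ 2) =
          2 + 2 / h ^ 2 + 2 * (h * ((k : ℝ) + θ)) ^ 2 + 2 * ((k : ℝ) + θ) ^ 2 := by
            field_simp
            ring
        rw [this]
        have : 0 ≤ 2 / h ^ 2 := by positivity
        nlinarith [sq_nonneg (h * ((k : ℝ) + θ))]
      calc (1 : ℝ) = (k : ℝ) ^ 2 / (k : ℝ) ^ 2 := by field_simp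
        _ ≤ ((2 + 2 / h ^ 2) * (1 + (h * ((k : ℝ) + θ)) ^ 2)) / (k : ℝ) ^ 2 := by gcongr
        _ = _ := by ring
  calc _ ≤ ∑ m ∈ s, ((2 + 2 / h ^ 2) * (1 / (((m + n : ℤ) : ℝ) ^ 2)) + (if m + n = 0 then 1 else 0)) :=
        Finset.sum_le_sum fun m _ => hle m
    _ = ∑ k ∈ s.map (Equiv.addRight n).toEmbedding,
        ((2 + 2 / h ^ 2) * (1 / ((k : ℝ) ^ 2)) + (if k = 0 then 1 else 0)) := by
        rw [Finset.sum_map]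
        rfl
    _ ≤ _ := hs.sum_le_tsum _ fun k _ => by positivity

/-- The samples of an integrable band-limited function are absolutely summable. -/
lemma summable_samples {q : ℝ → ℂ} {B h : ℝ} (hq : Continuous q) (hqi : Integrable q)
    (hB : ∀ ξ, B ≤ |ξ| → 𝓕 q ξ = 0) (hh : 0 < h) (t : ℝ) :
    Summable (fun m : ℤ => ‖q (t - m * h)‖) := by
  obtain ⟨C, hC, hker⟩ := exists_kernel_bound hq hqi hB
  obtain ⟨K, hK⟩ := exists_sum_kernel_le hh
  refine summable_of_sum_le (c := ∫ s, ‖q s‖ * (C * K)) (fun _ => norm_nonneg _) fun u => ?_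
  have hint : ∀ x, Integrable (fun s => ‖q s‖ * (C / (1 + (s - x) ^ 2))) := fun x => by
    refine hqi.norm.mul_bdd (c := C) ?_ (ae_of_all _ fun s => ?_)
    · refine Continuous.aestronglyMeasurable (continuous_const.div (by fun_prop) fun s => ?_)
      positivity
    · rw [Real.norm_of_nonneg (by positivity)]
      exact div_le_self hC (by nlinarith [sq_nonneg (s - x)])
  calc ∑ m ∈ u, ‖q (t - m * h)‖
      ≤ ∑ m ∈ u, ∫ s, ‖q s‖ * (C / (1 + (s - (t - m * h)) ^ 2)) :=
        Finset.sum_le_sum fun m _ => hker _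
    _ = ∫ s, ∑ m ∈ u, ‖q s‖ * (C / (1 + (s - (t - m * h)) ^ 2)) :=
        (integral_finsetSum _ fun m _ => hint _).symm
    _ ≤ _ := by
        refine integral_mono (integrable_finsetSum _ fun m _ => hint _)
          (hqi.norm.mul_const _) fun s => ?_
        have e : ∀ m : ℤ, ‖q s‖ * (C / (1 + (s - (t - m * h)) ^ 2)) =
            ‖q s‖ * C * (1 / (1 + ((s - t) + m * h) ^ 2)) := fun m => by
          rw [show s - (t - m * h) = s - t + m * h by ring]; ring
        simp only [e, ← Finset.mul_sum]
        rw [← mul_assoc]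
        gcongr
        exact hK _ _

/-- Poisson summation for a signal sampled above the Nyquist rate: there is no aliasing. -/
lemma hasSum_samples {q : ℝ → ℂ} {B h : ℝ} (hq : Continuous q) (hqi : Integrable q)
    (hB : ∀ ξ, B ≤ |ξ| → 𝓕 q ξ = 0) (hh : 0 < h) (hBh : B * h ≤ 1 / 2) (t : ℝ) {ν : ℝ}
    (hν : |ν| ≤ 1 / 2) :
    HasSum (fun m : ℤ => q (t - m * h) * Complex.exp (-(2 * Real.pi * Complex.I * m * ν)))
      (1 / h * 𝓕 q (-ν / h) * Complex.exp (-(2 * Real.pi * Complex.I * (ν / h) * t))) := by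
  have hFc := continuous_fourier hqi
  -- The plan: `f` vanishes for `|u| ≥ 1/2`, so it glues to a continuous function on the circle. Its
  -- Fourier coefficients are the samples of `q`; these are absolutely summable, so the Fourier
  -- series converges to `f` pointwise.
  set f : ℝ → ℂ := fun u => 1 / h * 𝓕 q (u / h) * Complex.exp (2 * Real.pi * Complex.I * (u / h) * t)
    with hf
  have hfc : Continuous f := by
    have : Continuous fun u : ℝ => 𝓕 q (u / h) := hFc.comp (continuous_id.div_const h)
    fun_prop
  have hvan : ∀ u : ℝ, 1 / 2 ≤ |u| → f u = 0 := fun u hu => by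
    have : 𝓕 q (u / h) = 0 := hB _ (by
      rw [abs_div, abs_of_pos hh, le_div_iff₀ hh]; linarith)
    simp [hf, this]
  have : Fact ((0 : ℝ) < 1) := ⟨one_pos⟩
  have hend : f (-(1 / 2)) = f (-(1 / 2) + 1) := by
    rw [hvan _ (by norm_num), hvan _ (by norm_num [abs_of_pos])]
  have hcont := AddCircle.liftIco_continuous (p := (1 : ℝ)) hend hfc.continuousOn
  let Φ : C(AddCircle (1 : ℝ), ℂ) := ⟨_, hcont⟩
  have hcoef : ∀ n : ℤ, fourierCoeff Φ n = q (t - n * h) := by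
    intro n
    change fourierCoeff (AddCircle.liftIco (1 : ℝ) (-(1 / 2)) f) n = _
    rw [fourierCoeff_liftIco_eq, fourierCoeffOn_eq_integral,
      intervalIntegral.integral_eq_integral_of_support_subset,
      eq_integral_of_bandlimited hq hqi hB]
    -- The substitution `u = h ξ` turns the coefficient integral into Fourier inversion at `t - n
    -- h`.
    · have e := Measure.integral_comp_div
        (fun ξ : ℝ => Complex.exp (2 * Real.pi * Complex.I * ξ * ((t - n * h : ℝ) : ℂ)) * 𝓕 q ξ) h
      rw [abs_of_pos hh] at e
      have hhc : (h : ℂ) ≠ 0 := by exact_mod_cast hh.ne'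
      have e2 : ∀ I : ℂ, I = (1 / h : ℂ) * (h • I) := fun I => by
        rw [Complex.real_smul]; field_simp
      rw [e2 (∫ ξ : ℝ, Complex.exp (2 * Real.pi * Complex.I * ξ * ((t - n * h : ℝ) : ℂ)) * 𝓕 q ξ),
        ← e, ← integral_const_mul]
      simp only [hf, add_sub_cancel_left, one_div, inv_one, one_smul]
      congr 1
      ext u
      rw [fourier_coe_apply, smul_eq_mul]
      push_cast
      rw [show 2 * (Real.pi : ℂ) * Complex.I * (u / h) * (t - n * h) =
        2 * Real.pi * Complex.I * (-n) * u / (-(1 / 2) + 1 - -(1 / 2)) + 2 * Real.pi * Complex.I * (u / h) * t by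
          field_simp; ring, Complex.exp_add]
      ring
    · intro u hu
      by_contra hcon
      apply hu
      have : f u = 0 := hvan u (by
        by_contra! h2
        rw [abs_lt] at h2
        exact hcon ⟨h2.1, by linarith [h2.2]⟩)
      simp [this]
  have hsum : Summable (fourierCoeff Φ) := by
    refine Summable.of_norm ?_
    simp only [hcoef]
    exact summable_samples hq hqi hB hh t
  have hval : ∀ u : ℝ, |u| ≤ 1 / 2 → Φ (u : AddCircle (1 : ℝ)) = f u := by
    intro u hu
    rw [abs_le] at hu
    change AddCircle.liftIco (1 : ℝ) (-(1 / 2)) f u = f u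
    rcases eq_or_lt_of_le hu.2 with h2 | h2
    -- The right endpoint is outside the half-open fundamental interval and is identified with
    -- `-1/2`.
    · rw [h2, show ((1 / 2 : ℝ) : AddCircle (1 : ℝ)) = ((-(1 / 2) : ℝ) : AddCircle (1 : ℝ)) by
        rw [show (1 / 2 : ℝ) = -(1 / 2) + 1 by norm_num, AddCircle.coe_add_period]; norm_num,
        AddCircle.liftIco_coe_apply ⟨le_rfl, by norm_num⟩, hend]
      norm_num
    · exact AddCircle.liftIco_coe_apply ⟨hu.1, by linarith⟩
  have hfin := has_pointwise_sum_fourier_series_of_summable hsum ((-ν : ℝ) : AddCircle (1 : ℝ))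
  rw [hval (-ν) (by rwa [abs_neg])] at hfin
  convert! hfin using 2
  · rename_i m
    rw [hcoef, fourier_coe_apply, smul_eq_mul]
    congr 2
    push_cast
    ring
  · push_cast
    congr 2
    ring

/-! ### The energy spectrum of a real pulse -/

lemma fourier_ofReal_neg (p : ℝ → ℝ) (ξ : ℝ) :
    𝓕 (fun s : ℝ => (p s : ℂ)) (-ξ) = (starRingEnd ℂ) (𝓕 (fun s : ℝ => (p s : ℂ)) ξ) := by
  rw [Real.fourier_real_eq_integral_exp_smul, Real.fourier_real_eq_integral_exp_smul,
    ← integral_conj]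
  refine integral_congr_ae (ae_of_all _ fun v => ?_)
  simp only [smul_eq_mul, map_mul, Complex.conj_ofReal, ← Complex.exp_conj, Complex.conj_I]
  congr 2
  push_cast
  ring

lemma matchedFilter_eq_convolution (p : ℝ → ℝ) :
    (fun t => (matchedFilter p t : ℂ)) =
      convolution (fun s : ℝ => (p s : ℂ)) (fun s : ℝ => (p (-s) : ℂ))
        (ContinuousLinearMap.mul ℂ ℂ) volume := by
  ext t
  rw [convolution_def, matchedFilter, ← integral_complex_ofReal]
  refine integral_congr_ae (ae_of_all _ fun s => ?_)
  simp

/-- The energy spectrum is the squared modulus of the Fourier transform of the pulse. -/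
lemma fourier_matchedFilter {p : ℝ → ℝ} (hp : Integrable p) (ξ : ℝ) :
    𝓕 (fun t : ℝ => (matchedFilter p t : ℂ)) ξ =
      ((‖𝓕 (fun s : ℝ => (p s : ℂ)) ξ‖ ^ 2 : ℝ) : ℂ) := by
  have hmul := Real.fourier_mul_convolution_eq (f₁ := fun s : ℝ => (p s : ℂ))
    (f₂ := fun s : ℝ => (p (-s) : ℂ)) hp.ofReal hp.comp_neg.ofReal ξ
  rw [matchedFilter_eq_convolution, hmul]
  have := Real.fourier_comp_linearIsometry (LinearIsometryEquiv.neg ℝ) (fun s : ℝ => (p s : ℂ)) ξ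
  simp only [Function.comp_def, LinearIsometryEquiv.coe_neg] at this
  rw [this, fourier_ofReal_neg, Complex.mul_conj']
  norm_cast

lemma energySpectrum_eq {p : ℝ → ℝ} (hp : Integrable p) (ξ : ℝ) :
    energySpectrum p ξ = ‖𝓕 (fun s : ℝ => (p s : ℂ)) ξ‖ ^ 2 := by
  rw [energySpectrum, fourier_matchedFilter hp, Complex.ofReal_re]

lemma energySpectrum_neg {p : ℝ → ℝ} (hp : Integrable p) (ξ : ℝ) :
    energySpectrum p (-ξ) = energySpectrum p ξ := by
  rw [energySpectrum_eq hp, energySpectrum_eq hp, fourier_ofReal_neg, RCLike.norm_conj]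

lemma energySpectrum_nonneg {p : ℝ → ℝ} (hp : Integrable p) (ξ : ℝ) : 0 ≤ energySpectrum p ξ := by
  rw [energySpectrum_eq hp]
  positivity

lemma continuous_energySpectrum {p : ℝ → ℝ} (hp : Integrable p) :
    Continuous (energySpectrum p) := by
  rw [funext (energySpectrum_eq hp)]
  exact (continuous_fourier hp.ofReal).norm.pow 2

/-! ### Generating function and sampled spectrum of a pulse -/

namespace IsPulse

variable {p : ℝ → ℝ} {T β : ℝ}

lemma fourier_eq_zero (hp : IsPulse p T β) (ξ : ℝ) (hξ : (1 + β) / (2 * T) ≤ |ξ|) :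
    𝓕 (fun s : ℝ => (p s : ℂ)) ξ = 0 := by
  have h : energySpectrum p ξ = 0 := by
    by_contra h
    exact absurd ((hp.band ξ).1 h) hξ.not_gt
  rw [energySpectrum_eq hp.integrable] at h
  simpa using h

lemma fourier_matchedFilter_eq_zero (hp : IsPulse p T β) (ξ : ℝ)
    (hξ : (1 + β) / (2 * T) ≤ |ξ|) : 𝓕 (fun t : ℝ => (matchedFilter p t : ℂ)) ξ = 0 := by
  rw [fourier_matchedFilter hp.integrable, hp.fourier_eq_zero ξ hξ]
  simp

lemma integrable_matchedFilter (hp : IsPulse p T β) :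
    Integrable fun t : ℝ => (matchedFilter p t : ℂ) := by
  rw [matchedFilter_eq_convolution]
  exact hp.integrable.ofReal.integrable_convolution _ hp.integrable.comp_neg.ofReal

lemma continuous_ofReal (hp : IsPulse p T β) : Continuous fun s : ℝ => (p s : ℂ) :=
  Complex.continuous_ofReal.comp hp.continuous

/-- Band limitation makes the Fourier transform integrable, and inversion bounds the pulse by its
`L¹` norm. Boundedness is what makes the convolution defining the matched filter continuous. -/
lemma bddAbove_norm (hp : IsPulse p T β) :
    BddAbove (Set.range fun s : ℝ => ‖(p s : ℂ)‖) := by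
  refine ⟨∫ ξ, ‖𝓕 (fun s : ℝ => (p s : ℂ)) ξ‖, ?_⟩
  rintro _ ⟨s, rfl⟩
  have hF := integrable_of_continuous_of_vanishing (continuous_fourier hp.integrable.ofReal)
    hp.fourier_eq_zero
  have h := congrFun (hp.continuous_ofReal.fourierInv_fourier_eq hp.integrable.ofReal hF) s
  simp only at h ⊢
  rw [← h]
  exact VectorFourier.norm_fourierIntegral_le_integral_norm _ _ _ _ _

lemma continuous_matchedFilter (hp : IsPulse p T β) :
    Continuous fun t : ℝ => (matchedFilter p t : ℂ) := by
  rw [matchedFilter_eq_convolution]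
  refine BddAbove.continuous_convolution_right_of_integrable _ ?_ hp.integrable.ofReal
    (hp.continuous_ofReal.comp continuous_neg)
  refine hp.bddAbove_norm.mono ?_
  rintro _ ⟨s, rfl⟩
  exact ⟨-s, rfl⟩

/-- Faster-than-Nyquist sampling without aliasing: the generating function is the rescaled energy
spectrum. -/
lemma generatingFunction_eq (hp : IsPulse p T β) {h : ℝ} (hh : 0 < h)
    (hBh : (1 + β) / (2 * T) * h ≤ 1 / 2) {f : ℝ} (hf : |f| ≤ 1 / 2) :
    generatingFunction p h f = 1 / h * energySpectrum p (f / h) := by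
  have key := hasSum_samples hp.continuous_matchedFilter hp.integrable_matchedFilter
    hp.fourier_matchedFilter_eq_zero hh hBh 0 hf
  -- At `t = 0` the sampling formula involves `g (-m h)` and `exp (-2 π i m f)`; reflecting the
  -- index restores both signs.
  have key2 := (Equiv.neg ℤ).hasSum_iff.2 key
  have e : ∀ k : ℤ, (matchedFilter p (k * h) : ℂ) * Complex.exp (2 * Real.pi * Complex.I * f * k) =
      ((fun m : ℤ => (matchedFilter p (0 - m * h) : ℂ) *
        Complex.exp (-(2 * Real.pi * Complex.I * m * f))) ∘ Equiv.neg ℤ) k := fun k => by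
    simp only [Function.comp_apply, Equiv.neg_apply, Int.cast_neg, neg_mul, zero_sub, neg_neg]
    congr 2
    ring
  rw [generatingFunction, tsum_congr e, key2.tsum_eq, fourier_matchedFilter hp.integrable,
    ← energySpectrum_eq hp.integrable, neg_div, energySpectrum_neg hp.integrable]
  simp only [Complex.ofReal_zero, mul_zero, neg_zero, Complex.exp_zero, mul_one]
  norm_cast

lemma generatingFunction_nonneg (hp : IsPulse p T β) {h : ℝ} (hh : 0 < h)
    (hBh : (1 + β) / (2 * T) * h ≤ 1 / 2) {f : ℝ} (hf : |f| ≤ 1 / 2) :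
    0 ≤ generatingFunction p h f := by
  rw [hp.generatingFunction_eq hh hBh hf]
  have := energySpectrum_nonneg hp.integrable (f / h)
  positivity

lemma generatingFunction_ne_zero_iff (hp : IsPulse p T β) {h : ℝ} (hh : 0 < h)
    (hBh : (1 + β) / (2 * T) * h ≤ 1 / 2) {f : ℝ} (hf : |f| ≤ 1 / 2) :
    generatingFunction p h f ≠ 0 ↔ |f| < (1 + β) / (2 * T) * h := by
  rw [hp.generatingFunction_eq hh hBh hf, mul_ne_zero_iff, hp.band, abs_div, abs_of_pos hh,
    div_lt_iff₀ hh]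
  simp [hh.ne']

lemma continuousOn_generatingFunction (hp : IsPulse p T β) {h : ℝ} (hh : 0 < h)
    (hBh : (1 + β) / (2 * T) * h ≤ 1 / 2) :
    ContinuousOn (generatingFunction p h) (Set.Icc (-(1 / 2)) (1 / 2)) := by
  have : Continuous fun f => 1 / h * energySpectrum p (f / h) :=
    continuous_const.mul ((continuous_energySpectrum hp.integrable).comp (continuous_id.div_const h))
  exact this.continuousOn.congr fun f hf => hp.generatingFunction_eq hh hBh (abs_le.2 hf)

/-- The spectrum of the sampled pulse at every sampling phase. -/
lemma norm_sq_tsum_samples (hp : IsPulse p T β) {h : ℝ} (hh : 0 < h)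
    (hBh : (1 + β) / (2 * T) * h ≤ 1 / 2) (t : ℝ) {ν : ℝ} (hν : |ν| ≤ 1 / 2) :
    ‖∑' m : ℤ, Complex.exp (-(2 * Real.pi * Complex.I * m * ν)) * (p (t - m * h) : ℂ)‖ ^ 2 =
      1 / h * generatingFunction p h ν := by
  have key := hasSum_samples hp.continuous_ofReal hp.integrable.ofReal hp.fourier_eq_zero hh hBh t hν
  rw [tsum_congr fun m : ℤ => mul_comm _ _, key.tsum_eq, hp.generatingFunction_eq hh hBh hν,
    ← energySpectrum_neg hp.integrable, energySpectrum_eq hp.integrable, ← neg_div, norm_mul,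
    norm_mul, show -(2 * Real.pi * Complex.I * (ν / h) * t : ℂ) =
      ((-(2 * Real.pi * (ν / h) * t) : ℝ) : ℂ) * Complex.I by push_cast; ring,
    Complex.norm_exp_ofReal_mul_I]
  simp only [norm_div, norm_one, Complex.norm_real, Real.norm_of_nonneg hh.le]
  ring

lemma summable_norm_samples (hp : IsPulse p T β) {h : ℝ} (hh : 0 < h) (t : ℝ) :
    Summable fun m : ℤ => ‖(p (t - m * h) : ℂ)‖ :=
  summable_samples hp.continuous_ofReal hp.integrable.ofReal hp.fourier_eq_zero hh t

end IsPulse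

/-! ### Strict concavity of the rate -/

section Jensen

variable {κ k : ℝ}

/-- The tangent of `y ↦ log (1 + κ y)` at `k` lies above the graph. -/
lemma log_one_add_mul_le (hκ : 0 < κ) (hk : 0 ≤ k) {y : ℝ} (hy : 0 ≤ y) :
    Real.log (1 + κ * y) ≤ Real.log (1 + κ * k) + κ / (1 + κ * k) * (y - k) := by
  have h1 : 0 < 1 + κ * k := by positivity
  have h2 : 0 < 1 + κ * y := by positivity
  have h := Real.log_le_sub_one_of_pos (div_pos h2 h1)
  rw [Real.log_div h2.ne' h1.ne'] at h
  have e : (1 + κ * y) / (1 + κ * k) - 1 = κ / (1 + κ * k) * (y - k) := by field_simp; ring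
  linarith

/-- Equality case of the tangent inequality: `log u < u - 1` unless `u = 1`, for `u = (1 + κ y) / (1
+ κ k)`. -/
lemma eq_of_log_one_add_mul_eq (hκ : 0 < κ) (hk : 0 ≤ k) {y : ℝ} (hy : 0 ≤ y)
    (h : Real.log (1 + κ * y) = Real.log (1 + κ * k) + κ / (1 + κ * k) * (y - k)) : y = k := by
  have h1 : 0 < 1 + κ * k := by positivity
  have h2 : 0 < 1 + κ * y := by positivity
  by_contra hne
  have hne' : (1 + κ * y) / (1 + κ * k) ≠ 1 := by
    rw [Ne, div_eq_one_iff_eq h1.ne']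
    intro h3
    exact hne (mul_left_cancel₀ hκ.ne' (by linarith))
  have h4 := Real.log_lt_sub_one_of_pos (div_pos h2 h1) hne'
  rw [Real.log_div h2.ne' h1.ne'] at h4
  have e : (1 + κ * y) / (1 + κ * k) - 1 = κ / (1 + κ * k) * (y - k) := by field_simp; ring
  linarith

variable {w : ℝ} {y : ℝ → ℝ}

lemma integrableOn_log_one_add_mul {A : Set ℝ} (hA : MeasurableSet A) (hκ : 0 < κ)
    (hy : IntegrableOn y A) (hy0 : ∀ f ∈ A, 0 ≤ y f) :
    IntegrableOn (fun f => Real.log (1 + κ * y f)) A := by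
  refine (hy.const_mul κ).mono' ?_ ((ae_restrict_iff' hA).2 (ae_of_all _ fun f hf => ?_))
  · exact (Real.measurable_log.comp_aemeasurable
      ((hy.aemeasurable.const_mul κ).const_add 1)).aestronglyMeasurable
  · have h0 : 0 ≤ κ * y f := mul_nonneg hκ.le (hy0 f hf)
    rw [Real.norm_of_nonneg (Real.log_nonneg (by linarith))]
    linarith [Real.log_le_sub_one_of_pos (show 0 < 1 + κ * y f by linarith)]

/-- Integral form of the tangent inequality, for the defect in the tangent inequality. -/
lemma integral_defect (hκ : 0 < κ) (hw : 0 ≤ w)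
    (hy : IntegrableOn y (Set.Ioo (-w) w)) (hy0 : ∀ f ∈ Set.Ioo (-w) w, 0 ≤ y f) :
    ∫ f in Set.Ioo (-w) w,
        (Real.log (1 + κ * k) + κ / (1 + κ * k) * (y f - k) - Real.log (1 + κ * y f)) =
      2 * w * Real.log (1 + κ * k) + κ / (1 + κ * k) * ((∫ f in Set.Ioo (-w) w, y f) - 2 * w * k) -
        ∫ f in Set.Ioo (-w) w, Real.log (1 + κ * y f) := by
  have hlog := integrableOn_log_one_add_mul measurableSet_Ioo hκ hy hy0
  have hc : ∀ c : ℝ, IntegrableOn (fun _ => c) (Set.Ioo (-w) w) := fun c =>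
    integrableOn_const (by simp)
  have hci : ∀ c : ℝ, ∫ _ in Set.Ioo (-w) w, c = 2 * w * c := fun c => by
    rw [setIntegral_const, measureReal_def, Real.volume_Ioo, ENNReal.toReal_ofReal (by linarith),
      smul_eq_mul]
    ring
  have hlin : IntegrableOn (fun f => κ / (1 + κ * k) * (y f - k)) (Set.Ioo (-w) w) :=
    (hy.sub (hc k)).const_mul _
  have hsum : IntegrableOn (fun f => Real.log (1 + κ * k) + κ / (1 + κ * k) * (y f - k))
      (Set.Ioo (-w) w) := (hc _).add hlin
  rw [integral_sub hsum hlog, integral_add (hc _) hlin, integral_const_mul, integral_sub hy (hc k),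
    hci, hci]

/-- Among all distributions of power over a band, the flat one maximizes the rate. -/
lemma integral_log_le (hκ : 0 < κ) (hk : 0 ≤ k) (hw : 0 ≤ w)
    (hy : IntegrableOn y (Set.Ioo (-w) w)) (hy0 : ∀ f ∈ Set.Ioo (-w) w, 0 ≤ y f)
    (hpow : ∫ f in Set.Ioo (-w) w, y f ≤ 2 * w * k) :
    ∫ f in Set.Ioo (-w) w, Real.log (1 + κ * y f) ≤ 2 * w * Real.log (1 + κ * k) := by
  have h1 := integral_defect (k := k) hκ hw hy hy0
  have h2 : 0 ≤ ∫ f in Set.Ioo (-w) w,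
        (Real.log (1 + κ * k) + κ / (1 + κ * k) * (y f - k) - Real.log (1 + κ * y f)) :=
    setIntegral_nonneg measurableSet_Ioo fun f hf =>
      sub_nonneg.2 (log_one_add_mul_le hκ hk (hy0 f hf))
  have h3 : κ / (1 + κ * k) * ((∫ f in Set.Ioo (-w) w, y f) - 2 * w * k) ≤ 0 :=
    mul_nonpos_of_nonneg_of_nonpos (by positivity) (by linarith)
  linarith

/-- Only the flat power distribution attains the maximal rate. -/
lemma ae_eq_of_integral_log_ge (hκ : 0 < κ) (hk : 0 ≤ k) (hw : 0 ≤ w)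
    (hy : IntegrableOn y (Set.Ioo (-w) w)) (hy0 : ∀ f ∈ Set.Ioo (-w) w, 0 ≤ y f)
    (hpow : ∫ f in Set.Ioo (-w) w, y f ≤ 2 * w * k)
    (hge : 2 * w * Real.log (1 + κ * k) ≤ ∫ f in Set.Ioo (-w) w, Real.log (1 + κ * y f)) :
    y =ᵐ[volume.restrict (Set.Ioo (-w) w)] fun _ => k := by
  have h1 := integral_defect (k := k) hκ hw hy hy0
  have hlog := integrableOn_log_one_add_mul measurableSet_Ioo hκ hy hy0
  have hc : ∀ c : ℝ, IntegrableOn (fun _ => c) (Set.Ioo (-w) w) := fun c =>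
    integrableOn_const (by simp)
  have hD0 : ∀ᵐ f ∂volume.restrict (Set.Ioo (-w) w),
      0 ≤ Real.log (1 + κ * k) + κ / (1 + κ * k) * (y f - k) - Real.log (1 + κ * y f) :=
    (ae_restrict_iff' measurableSet_Ioo).2 (ae_of_all _ fun f hf =>
      sub_nonneg.2 (log_one_add_mul_le hκ hk (hy0 f hf)))
  have h3 : κ / (1 + κ * k) * ((∫ f in Set.Ioo (-w) w, y f) - 2 * w * k) ≤ 0 :=
    mul_nonpos_of_nonneg_of_nonpos (by positivity) (by linarith)
  -- The defect is nonnegative, while the power constraint and the assumed rate make its integral at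
  -- most `0`; so it vanishes almost everywhere.
  have hD : ∫ f in Set.Ioo (-w) w,
        (Real.log (1 + κ * k) + κ / (1 + κ * k) * (y f - k) - Real.log (1 + κ * y f)) = 0 :=
    le_antisymm (by linarith) (integral_nonneg_of_ae hD0)
  have hz := (integral_eq_zero_iff_of_nonneg_ae hD0
    (((hc _).add ((hy.sub (hc k)).const_mul _)).sub hlog)).1 hD
  filter_upwards [hz, ae_restrict_mem measurableSet_Ioo] with f hf hfA
  simp only [Pi.zero_apply] at hf
  exact eq_of_log_one_add_mul_eq hκ hk (hy0 f hfA) (by linarith)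

end Jensen

/-! ### Optimal power allocation -/

namespace IsPulse

variable {p : ℝ → ℝ} {T β δ : ℝ}

/-- The bound on `δ` enters here. Strictness is also needed when grid frequencies in the band are
counted. -/
lemma half_band_lt (hβ : 0 < β) (hδ : δ ∈ Set.Ioo (0 : ℝ) (1 / (1 + β))) :
    δ * (1 + β) / 2 < 1 / 2 := by
  have := (lt_div_iff₀ (by linarith : 0 < 1 + β)).1 hδ.2
  linarith

lemma nyquist_rate (hT : 0 < T) (hβ : 0 < β) (hδ : δ ∈ Set.Ioo (0 : ℝ) (1 / (1 + β))) :
    (1 + β) / (2 * T) * (δ * T) ≤ 1 / 2 := by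
  have h : (1 + β) / (2 * T) * (δ * T) = δ * (1 + β) / 2 := by field_simp
  rw [h]
  exact (half_band_lt hβ hδ).le

lemma generatingFunction_ne_zero (hp : IsPulse p T β) (hT : 0 < T) (hβ : 0 < β)
    (hδ : δ ∈ Set.Ioo (0 : ℝ) (1 / (1 + β))) {f : ℝ} (hf : |f| ≤ 1 / 2) :
    generatingFunction p (δ * T) f ≠ 0 ↔ |f| < δ * (1 + β) / 2 := by
  rw [hp.generatingFunction_ne_zero_iff (mul_pos hδ.1 hT) (nyquist_rate hT hβ hδ) hf,
    show (1 + β) / (2 * T) * (δ * T) = δ * (1 + β) / 2 by field_simp]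

lemma band_subset (hβ : 0 < β) (hδ : δ ∈ Set.Ioo (0 : ℝ) (1 / (1 + β))) :
    Set.Ioo (-(δ * (1 + β) / 2)) (δ * (1 + β) / 2) ⊆ Set.Icc (-(1 / 2)) (1 / 2) := fun f hf =>
  ⟨by linarith [hf.1, half_band_lt hβ hδ], by linarith [hf.2, half_band_lt hβ hδ]⟩

/-- Integrals over the Nyquist interval of functions of `S 𝒢` reduce to the band of the pulse. -/
lemma setIntegral_band (hp : IsPulse p T β) (hT : 0 < T) (hβ : 0 < β)
    (hδ : δ ∈ Set.Ioo (0 : ℝ) (1 / (1 + β))) (S φ : ℝ → ℝ) (hφ : φ 0 = 0) :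
    ∫ f in Set.Icc (-(1 / 2) : ℝ) (1 / 2), φ (S f * generatingFunction p (δ * T) f) =
      ∫ f in Set.Ioo (-(δ * (1 + β) / 2)) (δ * (1 + β) / 2),
        φ (S f * generatingFunction p (δ * T) f) := by
  refine setIntegral_eq_of_subset_of_forall_sdiff_eq_zero measurableSet_Icc (band_subset hβ hδ)
    fun f hf => ?_
  have hz : generatingFunction p (δ * T) f = 0 := by
    by_contra h
    exact hf.2 (abs_lt.1 ((hp.generatingFunction_ne_zero hT hβ hδ (abs_le.2 hf.1)).1 h))
  rw [hz, mul_zero, hφ]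

lemma informationRate_eq (hp : IsPulse p T β) (hT : 0 < T) (hβ : 0 < β)
    (hδ : δ ∈ Set.Ioo (0 : ℝ) (1 / (1 + β))) (c : ℂ) (σ₀ : ℝ) (S : ℝ → ℝ) :
    informationRate p (δ * T) c σ₀ S =
      (∫ f in Set.Ioo (-(δ * (1 + β) / 2)) (δ * (1 + β) / 2),
        Real.log (1 + ‖c‖ ^ 2 / σ₀ ^ 2 * (S f * generatingFunction p (δ * T) f))) / Real.log 2 := by
  rw [informationRate, hp.setIntegral_band hT hβ hδ S
    (fun y => Real.logb 2 (1 + ‖c‖ ^ 2 * y / σ₀ ^ 2)) (by simp), ← integral_div]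
  refine integral_congr_ae (ae_of_all _ fun f => ?_)
  simp only [Real.logb]
  congr 3
  ring

lemma spectralPower_eq (hp : IsPulse p T β) (hT : 0 < T) (hβ : 0 < β)
    (hδ : δ ∈ Set.Ioo (0 : ℝ) (1 / (1 + β))) (S : ℝ → ℝ) :
    spectralPower p (δ * T) S = 1 / (δ * T) *
      ∫ f in Set.Ioo (-(δ * (1 + β) / 2)) (δ * (1 + β) / 2),
        S f * generatingFunction p (δ * T) f := by
  rw [spectralPower, hp.setIntegral_band hT hβ hδ S (fun y => y) rfl]

/-- The level `P T / (1 + β)` is the budget `P δ T` spread evenly over the bandwidth `δ (1 + β)`. -/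
lemma integral_le_of_isAdmissible (hp : IsPulse p T β) (hT : 0 < T) (hβ : 0 < β)
    (hδ : δ ∈ Set.Ioo (0 : ℝ) (1 / (1 + β))) {P : ℝ} {S : ℝ → ℝ}
    (hS : IsAdmissible p (δ * T) P S) :
    ∫ f in Set.Ioo (-(δ * (1 + β) / 2)) (δ * (1 + β) / 2),
        S f * generatingFunction p (δ * T) f ≤ 2 * (δ * (1 + β) / 2) * (P * T / (1 + β)) := by
  have h := hS.power
  have hh : 0 < δ * T := mul_pos hδ.1 hT
  rw [hp.spectralPower_eq hT hβ hδ, one_div, inv_mul_le_iff₀ hh] at h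
  refine h.trans (le_of_eq ?_)
  field_simp

lemma nonneg_of_isAdmissible (hp : IsPulse p T β) (hT : 0 < T) (hβ : 0 < β)
    (hδ : δ ∈ Set.Ioo (0 : ℝ) (1 / (1 + β))) {P : ℝ} {S : ℝ → ℝ}
    (hS : IsAdmissible p (δ * T) P S) {f : ℝ}
    (hf : f ∈ Set.Ioo (-(δ * (1 + β) / 2)) (δ * (1 + β) / 2)) :
    0 ≤ S f * generatingFunction p (δ * T) f := by
  have hI := band_subset hβ hδ hf
  exact mul_nonneg (hS.nonneg f hI) (hp.generatingFunction_nonneg (mul_pos hδ.1 hT)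
    (nyquist_rate hT hβ hδ) (abs_le.2 hI))

lemma inverseSpectrum_mul (hp : IsPulse p T β) (hT : 0 < T) (hβ : 0 < β)
    (hδ : δ ∈ Set.Ioo (0 : ℝ) (1 / (1 + β))) (P : ℝ) {f : ℝ} (hf : |f| < δ * (1 + β) / 2) :
    inverseSpectrum p T β δ P f * generatingFunction p (δ * T) f = P * T / (1 + β) := by
  have hf2 : |f| ≤ 1 / 2 := (hf.trans (half_band_lt hβ hδ)).le
  have hne := (hp.generatingFunction_ne_zero hT hβ hδ hf2).2 hf
  have hh : 0 < δ * T := mul_pos hδ.1 hT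
  rw [hp.generatingFunction_eq hh (nyquist_rate hT hβ hδ) hf2] at hne ⊢
  have hG : energySpectrum p (f / (δ * T)) ≠ 0 := right_ne_zero_of_mul hne
  have := hδ.1.ne'
  rw [inverseSpectrum, if_pos hf]
  field_simp

lemma inverseSpectrum_nonneg (hp : IsPulse p T β) (hT : 0 < T) (hβ : 0 < β) (hδ : 0 < δ) {P : ℝ}
    (hP : 0 ≤ P) (f : ℝ) : 0 ≤ inverseSpectrum p T β δ P f := by
  have := energySpectrum_nonneg hp.integrable (f / (δ * T))
  rw [inverseSpectrum]
  split_ifs <;> positivity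

lemma integral_inverseSpectrum (hp : IsPulse p T β) (hT : 0 < T) (hβ : 0 < β)
    (hδ : δ ∈ Set.Ioo (0 : ℝ) (1 / (1 + β))) (P : ℝ) (φ : ℝ → ℝ) :
    ∫ f in Set.Ioo (-(δ * (1 + β) / 2)) (δ * (1 + β) / 2),
        φ (inverseSpectrum p T β δ P f * generatingFunction p (δ * T) f) =
      2 * (δ * (1 + β) / 2) * φ (P * T / (1 + β)) := by
  rw [setIntegral_congr_fun (g := fun _ => φ (P * T / (1 + β))) measurableSet_Ioo fun f hf => by
    simp only [hp.inverseSpectrum_mul hT hβ hδ P (abs_lt.2 hf)],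
    setIntegral_const, measureReal_def, Real.volume_Ioo, ENNReal.toReal_ofReal, smul_eq_mul]
  · ring
  · have := hδ.1
    linarith [show 0 < δ * (1 + β) / 2 by positivity]

lemma isAdmissible_inverseSpectrum (hp : IsPulse p T β) (hT : 0 < T) (hβ : 0 < β)
    (hδ : δ ∈ Set.Ioo (0 : ℝ) (1 / (1 + β))) {P : ℝ} (hP : 0 ≤ P) :
    IsAdmissible p (δ * T) P (inverseSpectrum p T β δ P) where
  nonneg f _ := hp.inverseSpectrum_nonneg hT hβ hδ.1 hP f
  integrable := by
    have hind : IntegrableOn ((Set.Ioo (-(δ * (1 + β) / 2)) (δ * (1 + β) / 2)).indicator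
        fun _ => P * T / (1 + β)) (Set.Icc (-(1 / 2) : ℝ) (1 / 2)) :=
      (integrableOn_const (by simp)).indicator measurableSet_Ioo
    refine hind.congr_fun (fun f _ => ?_) measurableSet_Icc
    by_cases hf : f ∈ Set.Ioo (-(δ * (1 + β) / 2)) (δ * (1 + β) / 2)
    · rw [Set.indicator_of_mem hf]
      exact (hp.inverseSpectrum_mul hT hβ hδ P (abs_lt.2 hf)).symm
    · rw [Set.indicator_of_notMem hf]
      simp only [inverseSpectrum]
      rw [if_neg (fun h => hf (abs_lt.1 h)), zero_mul]
  power := by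
    rw [hp.spectralPower_eq hT hβ hδ, hp.integral_inverseSpectrum hT hβ hδ P fun y => y]
    have := hδ.1.ne'
    refine le_of_eq ?_
    field_simp

/-- Channel inversion inside the band of the pulse is an optimal power allocation. -/
lemma isOptimal_inverseSpectrum (hp : IsPulse p T β) (hT : 0 < T) (hβ : 0 < β)
    (hδ : δ ∈ Set.Ioo (0 : ℝ) (1 / (1 + β))) {P : ℝ} (hP : 0 ≤ P) {c : ℂ} (hc : c ≠ 0) {σ₀ : ℝ}
    (hσ₀ : 0 < σ₀) :
    IsOptimal p (δ * T) c σ₀ P (inverseSpectrum p T β δ P) where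
  admissible := hp.isAdmissible_inverseSpectrum hT hβ hδ hP
  maximal S' hS' := by
    have hδ0 := hδ.1
    rw [hp.informationRate_eq hT hβ hδ, hp.informationRate_eq hT hβ hδ,
      hp.integral_inverseSpectrum hT hβ hδ P fun y => Real.log (1 + ‖c‖ ^ 2 / σ₀ ^ 2 * y)]
    have := Real.log_pos one_lt_two
    gcongr
    exact integral_log_le (by positivity) (by positivity) (by positivity)
      (hS'.integrable.mono_set (band_subset hβ hδ))
      (fun f hf => hp.nonneg_of_isAdmissible hT hβ hδ hS' hf)
      (hp.integral_le_of_isAdmissible hT hβ hδ hS')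
  continuousOn := by
    have hG : ContinuousOn (fun f => P * (δ * T) * (T / ((1 + β) * energySpectrum p (f / (δ * T)))))
        {f | f ∈ Set.Icc (-(1 / 2) : ℝ) (1 / 2) ∧ generatingFunction p (δ * T) f ≠ 0} := by
      have hcG : Continuous fun f => energySpectrum p (f / (δ * T)) :=
        (continuous_energySpectrum hp.integrable).comp (continuous_id.div_const _)
      refine continuousOn_const.mul (continuousOn_const.div
        (continuous_const.mul hcG).continuousOn fun f hf => ?_)
      have hne := hf.2
      rw [hp.generatingFunction_eq (mul_pos hδ.1 hT) (nyquist_rate hT hβ hδ) (abs_le.2 hf.1)] at hne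
      exact mul_ne_zero (by positivity) (right_ne_zero_of_mul hne)
    refine hG.congr fun f hf => ?_
    rw [inverseSpectrum, if_pos ((hp.generatingFunction_ne_zero hT hβ hδ (abs_le.2 hf.1)).1 hf.2)]
  vanishing f hf h := by
    rw [inverseSpectrum, if_neg]
    exact fun hlt => (hp.generatingFunction_ne_zero hT hβ hδ (abs_le.2 hf)).2 hlt h

/-- Every optimal power allocation has a flat transmit spectrum inside the band of the pulse. -/
lemma mul_eq_of_isOptimal (hp : IsPulse p T β) (hT : 0 < T) (hβ : 0 < β)
    (hδ : δ ∈ Set.Ioo (0 : ℝ) (1 / (1 + β))) {P : ℝ} (hP : 0 ≤ P) {c : ℂ} (hc : c ≠ 0) {σ₀ : ℝ}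
    (hσ₀ : 0 < σ₀) {S : ℝ → ℝ} (hS : IsOptimal p (δ * T) c σ₀ P S) {f : ℝ} (hf : |f| ≤ 1 / 2) :
    S f * generatingFunction p (δ * T) f =
      if |f| < δ * (1 + β) / 2 then P * T / (1 + β) else 0 := by
  have hδ0 := hδ.1
  split_ifs with hfA
  · have hge := hS.maximal _ (hp.isAdmissible_inverseSpectrum hT hβ hδ hP)
    rw [hp.informationRate_eq hT hβ hδ, hp.informationRate_eq hT hβ hδ,
      hp.integral_inverseSpectrum hT hβ hδ P fun y => Real.log (1 + ‖c‖ ^ 2 / σ₀ ^ 2 * y),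
      div_le_div_iff_of_pos_right (Real.log_pos one_lt_two)] at hge
    have hae := ae_eq_of_integral_log_ge (by positivity) (by positivity) (by positivity)
      (hS.admissible.integrable.mono_set (band_subset hβ hδ))
      (fun f hf => hp.nonneg_of_isAdmissible hT hβ hδ hS.admissible hf)
      (hp.integral_le_of_isAdmissible hT hβ hδ hS.admissible) hge
    have hcont : ContinuousOn (fun f => S f * generatingFunction p (δ * T) f)
        (Set.Ioo (-(δ * (1 + β) / 2)) (δ * (1 + β) / 2)) := by
      refine (hS.continuousOn.mono fun u hu => ?_).mul
        ((hp.continuousOn_generatingFunction (mul_pos hδ.1 hT) (nyquist_rate hT hβ hδ)).mono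
          (band_subset hβ hδ))
      have hu1 := band_subset hβ hδ hu
      exact ⟨hu1, (hp.generatingFunction_ne_zero hT hβ hδ (abs_le.2 hu1)).2 (abs_lt.2 hu)⟩
    -- Functions continuous on an open set that agree almost everywhere agree at each point.
    exact Measure.eqOn_open_of_ae_eq hae isOpen_Ioo hcont continuousOn_const (abs_lt.1 hfA)
  · have hz : generatingFunction p (δ * T) f = 0 := by
      by_contra h
      exact hfA ((hp.generatingFunction_ne_zero hT hβ hδ hf).1 h)
    rw [hz, mul_zero]

end IsPulse

/-! ### Exponential law of the power of a circular Gaussian -/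

/-- Rayleigh tail: the squared modulus of a pair of independent centered Gaussians of variance `v`
is exponentially distributed. -/
lemma gaussianReal_prod_tail {v : NNReal} (hv : v ≠ 0) {γ : ℝ} (hγ : 0 ≤ γ) :
    ((gaussianReal 0 v).prod (gaussianReal 0 v)).real {z | γ ≤ z.1 ^ 2 + z.2 ^ 2} =
      Real.exp (-(γ / (2 * v))) := by
  have hv0 : (0 : ℝ) < v := by positivity
  set A : Set (ℝ × ℝ) := {z | γ ≤ z.1 ^ 2 + z.2 ^ 2} with hA
  have hAm : MeasurableSet A := measurableSet_le measurable_const (by fun_prop)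
  rw [gaussianReal_of_var_ne_zero _ hv, prod_withDensity (by fun_prop) (by fun_prop),
    measureReal_def, withDensity_apply _ hAm, ← lintegral_indicator hAm]
  rw [show (volume : Measure ℝ).prod volume = (volume : Measure (ℝ × ℝ)) from rfl,
    ← lintegral_comp_polarCoord_symm]
  have hc : ∀ q ∈ polarCoord.target, ENNReal.ofReal q.1 • A.indicator
      (fun a : ℝ × ℝ => gaussianPDF 0 v a.1 * gaussianPDF 0 v a.2) (polarCoord.symm q) =
      (Set.Ioi (0 : ℝ) ×ˢ Set.Ioo (-Real.pi) Real.pi).indicator (fun q : ℝ × ℝ =>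
      (Set.Ici (√γ)).indicator (fun r => ENNReal.ofReal
        (r / (2 * Real.pi * v) * Real.exp (-(r ^ 2 / (2 * v))))) q.1) q := by
    rintro ⟨r, θ⟩ hq
    have hr : 0 < r := hq.1
    rw [Set.indicator_of_mem (show (r, θ) ∈ Set.Ioi (0 : ℝ) ×ˢ Set.Ioo (-Real.pi) Real.pi from hq)]
    have e : (r * Real.cos θ) ^ 2 + (r * Real.sin θ) ^ 2 = r ^ 2 := by
      rw [mul_pow, mul_pow, ← mul_add, Real.cos_sq_add_sin_sq, mul_one]
    have hmem : polarCoord.symm (r, θ) ∈ A ↔ r ∈ Set.Ici √γ := by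
      simp only [hA, polarCoord_symm_apply, Set.mem_ofPred_eq, e, Set.mem_Ici]
      rw [Real.sqrt_le_left hr.le]
    by_cases hrA : r ∈ Set.Ici √γ
    · rw [Set.indicator_of_mem hrA, Set.indicator_of_mem (hmem.2 hrA), smul_eq_mul]
      simp only [polarCoord_symm_apply, gaussianPDF, gaussianPDFReal, sub_zero]
      rw [← ENNReal.ofReal_mul (by positivity), ← ENNReal.ofReal_mul hr.le]
      congr 1
      rw [mul_mul_mul_comm, ← Real.exp_add, ← mul_inv, Real.mul_self_sqrt (by positivity),
        show -(r * Real.cos θ) ^ 2 / (2 * (v : ℝ)) + -(r * Real.sin θ) ^ 2 / (2 * v) =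
          -(r ^ 2 / (2 * v)) by rw [← e]; ring]
      ring
    · rw [Set.indicator_of_notMem hrA, Set.indicator_of_notMem (fun h => hrA (hmem.1 h)), smul_zero]
  rw [setLIntegral_congr_fun polarCoord.open_target.measurableSet hc]
  have htarget : polarCoord.target = Set.Ioi (0 : ℝ) ×ˢ Set.Ioo (-Real.pi) Real.pi := rfl
  rw [htarget, setLIntegral_congr_fun (measurableSet_Ioi.prod measurableSet_Ioo)
    (fun q hq => Set.indicator_of_mem hq _)]
  have hmeas : Measurable ((Set.Ici (√γ)).indicator (fun r => ENNReal.ofReal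
        (r / (2 * Real.pi * v) * Real.exp (-(r ^ 2 / (2 * v)))))) :=
    Measurable.indicator (by fun_prop) measurableSet_Ici
  rw [show (volume : Measure (ℝ × ℝ)) = (volume : Measure ℝ).prod volume from rfl,
    ← Measure.prod_restrict]
  -- In polar coordinates the integrand depends only on the radius; the angle contributes its full
  -- measure `2 π`.
  have hprod := lintegral_prod_mul (μ := volume.restrict (Set.Ioi (0 : ℝ)))
    (ν := volume.restrict (Set.Ioo (-Real.pi) Real.pi)) hmeas.aemeasurable
    (aemeasurable_const (b := (1 : ENNReal)))
  simp only [mul_one] at hprod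
  rw [hprod, lintegral_one, Measure.restrict_apply_univ, Real.volume_Ioo,
    lintegral_indicator measurableSet_Ici, Measure.restrict_restrict measurableSet_Ici]
  have hae : (Set.Ici √γ ∩ Set.Ioi 0 : Set ℝ) =ᵐ[volume] Set.Ioi √γ := by
    have h1 : (Set.Ici √γ : Set ℝ) =ᵐ[volume] Set.Ioi √γ := Ioi_ae_eq_Ici.symm
    have h2 := ae_eq_set_inter h1 (ae_eq_refl (Set.Ioi (0 : ℝ)))
    rwa [Set.Ioi_inter_Ioi, max_eq_left (Real.sqrt_nonneg γ)] at h2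
  rw [Measure.restrict_congr_set hae]
  have hder : ∀ r ∈ Set.Ici √γ, HasDerivAt
      (fun r : ℝ => -(1 / (2 * Real.pi)) * Real.exp (-(r ^ 2 / (2 * v))))
      (r / (2 * Real.pi * v) * Real.exp (-(r ^ 2 / (2 * v)))) r := fun r _ => by
    have h1 : HasDerivAt (fun r : ℝ => -(r ^ 2 / (2 * (v : ℝ)))) (-(2 * r / (2 * v))) r := by
      simpa using ((hasDerivAt_pow 2 r).div_const (2 * (v : ℝ))).fun_neg
    convert! h1.exp.const_mul (-(1 / (2 * Real.pi))) using 1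
    field_simp
  have hpos : ∀ r ∈ Set.Ioi √γ, 0 ≤ r / (2 * Real.pi * v) * Real.exp (-(r ^ 2 / (2 * v))) :=
    fun r hr => by
      have : 0 ≤ r := (Real.sqrt_nonneg γ).trans (le_of_lt hr)
      positivity
  have hlim : Tendsto (fun r : ℝ => -(1 / (2 * Real.pi)) * Real.exp (-(r ^ 2 / (2 * v)))) atTop
      (𝓝 0) := by
    rw [← mul_zero (-(1 / (2 * Real.pi)))]
    refine (Real.tendsto_exp_neg_atTop_nhds_zero.comp ?_).const_mul _
    exact (tendsto_pow_atTop two_ne_zero).atTop_div_const (by positivity)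
  rw [← ofReal_integral_eq_lintegral_ofReal
    (integrableOn_Ioi_deriv_of_nonneg' hder hpos hlim)
    ((ae_restrict_iff' measurableSet_Ioi).2 (ae_of_all _ hpos)),
    integral_Ioi_of_hasDerivAt_of_nonneg' hder hpos hlim, ENNReal.toReal_mul,
    ENNReal.toReal_ofReal (by rw [zero_sub, neg_mul, neg_neg]; positivity),
    ENNReal.toReal_ofReal (by linarith [Real.pi_pos]), Real.sq_sqrt hγ]
  field_simp
  ring

/-- The power of a centered circularly symmetric complex Gaussian is exponentially distributed. -/
lemma measureReal_le_norm_sq {Ω : Type*} [MeasurableSpace Ω] {μ : Measure Ω}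
    {X : Ω → ℂ} (hX : HasGaussianLaw X μ) (hmean : ∫ ω, X ω ∂μ = 0) {v : ℝ} (hv : 0 < v)
    (hcov : ∫ ω, X ω * (starRingEnd ℂ) (X ω) ∂μ = v) (hpseudo : ∫ ω, X ω * X ω ∂μ = 0)
    {γ : ℝ} (hγ : 0 ≤ γ) :
    μ.real {ω | γ ≤ ‖X ω‖ ^ 2} = Real.exp (-(γ / v)) := by
  have : IsProbabilityMeasure μ := hX.isProbabilityMeasure
  have hL2 : MemLp X 2 μ := hX.memLp_two
  have hi : Integrable X μ := hL2.integrable one_le_two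
  have hpair : HasGaussianLaw (fun ω => ((X ω).re, (X ω).im)) μ :=
    hX.map_fun (Complex.reCLM.prod Complex.imCLM)
  have hre : HasGaussianLaw (fun ω => (X ω).re) μ := hX.map_fun Complex.reCLM
  have him : HasGaussianLaw (fun ω => (X ω).im) μ := hX.map_fun Complex.imCLM
  have hre2 : MemLp (fun ω => (X ω).re) 2 μ := hre.memLp_two
  have him2 : MemLp (fun ω => (X ω).im) 2 μ := him.memLp_two
  have m1 : ∫ ω, (X ω).re ∂μ = 0 := by
    have := integral_re hi
    simp only [RCLike.re_to_complex] at this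
    rw [this, hmean, Complex.zero_re]
  have m2 : ∫ ω, (X ω).im ∂μ = 0 := by
    have := integral_im hi
    simp only [RCLike.im_to_complex] at this
    rw [this, hmean, Complex.zero_im]
  have irr : Integrable (fun ω => (X ω).re ^ 2) μ := hre2.integrable_sq
  have iii : Integrable (fun ω => (X ω).im ^ 2) μ := him2.integrable_sq
  have iXX : Integrable (fun ω => X ω * X ω) μ := hL2.integrable_mul hL2
  have c1 : ∫ ω, (X ω).re ^ 2 ∂μ + ∫ ω, (X ω).im ^ 2 ∂μ = v := by
    rw [← integral_add irr iii]
    have : ∀ ω, X ω * (starRingEnd ℂ) (X ω) = (((X ω).re ^ 2 + (X ω).im ^ 2 : ℝ) : ℂ) := fun ω => by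
      rw [Complex.mul_conj, Complex.normSq_apply]; push_cast; ring
    simp only [this] at hcov
    rw [integral_complex_ofReal] at hcov
    exact_mod_cast hcov
  -- The real part of the pseudo-covariance equates the two second moments, so each is `v / 2`. Its
  -- imaginary part gives zero correlation, hence independence, because the pair is jointly
  -- Gaussian.
  have c2 : ∫ ω, (X ω).re ^ 2 ∂μ - ∫ ω, (X ω).im ^ 2 ∂μ = 0 := by
    rw [← integral_sub irr iii]
    have := integral_re iXX
    simp only [RCLike.re_to_complex, hpseudo, Complex.zero_re, Complex.mul_re] at this
    simpa only [pow_two] using this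
  have c3 : ∫ ω, (X ω).re * (X ω).im ∂μ = 0 := by
    have := integral_im iXX
    simp only [RCLike.im_to_complex, hpseudo, Complex.zero_im, Complex.mul_im] at this
    have e : ∀ ω, (X ω).re * (X ω).im + (X ω).im * (X ω).re = 2 * ((X ω).re * (X ω).im) :=
      fun ω => by ring
    simp only [e, integral_const_mul] at this
    linarith
  have v1 : Var[fun ω => (X ω).re; μ] = v / 2 := by
    rw [variance_of_integral_eq_zero hre.aemeasurable m1]
    linarith
  have v2 : Var[fun ω => (X ω).im; μ] = v / 2 := by
    rw [variance_of_integral_eq_zero him.aemeasurable m2]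
    linarith
  have hind : IndepFun (fun ω => (X ω).re) (fun ω => (X ω).im) μ := by
    refine hpair.indepFun_of_covariance_eq_zero ?_
    rw [covariance_eq_sub hre2 him2, m1, m2]
    simpa using c3
  have hlaw : μ.map (fun ω => ((X ω).re, (X ω).im)) =
      (gaussianReal 0 (v / 2).toNNReal).prod (gaussianReal 0 (v / 2).toNNReal) := by
    rw [(indepFun_iff_map_prod_eq_prod_map_map hre.aemeasurable him.aemeasurable).1 hind,
      hre.map_eq_gaussianReal, him.map_eq_gaussianReal, m1, m2, v1, v2]
  have htail := gaussianReal_prod_tail (v := (v / 2).toNNReal)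
    (by simpa using hv) hγ
  rw [← hlaw, map_measureReal_apply_of_aemeasurable hpair.aemeasurable
    (measurableSet_le measurable_const (by fun_prop)), Real.coe_toNNReal _ (by positivity)] at htail
  rw [show γ / v = γ / (2 * (v / 2)) by ring, ← htail]
  congr 1
  ext ω
  rw [Set.mem_preimage, Set.mem_ofPred_eq, Set.mem_ofPred_eq, ← Complex.normSq_eq_norm_sq,
    Complex.normSq_apply, pow_two, pow_two]

/-! ### Linear combinations of the symbols -/

section Gaussian

variable {ι Ω : Type*} [Fintype ι] [MeasurableSpace Ω] {a : ι → Ω → ℂ} {C : Matrix ι ι ℂ}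
  {μ : Measure Ω}

namespace IsCircularGaussian

lemma memLp (ha : IsCircularGaussian a C μ) (i : ι) : MemLp (a i) 2 μ :=
  (ha.gaussian.eval i).memLp_two

lemma hasGaussianLaw_sum (ha : IsCircularGaussian a C μ) (z : ι → ℂ) :
    HasGaussianLaw (fun ω => ∑ i, a i ω * z i) μ := by
  -- Gaussian laws are preserved by real-linear maps, so the complex-linear functional is restricted
  -- to real scalars.
  have h := ha.gaussian.map_fun
    ((∑ i, z i • (ContinuousLinearMap.proj (R := ℂ) (φ := fun _ : ι => ℂ) i)).restrictScalars ℝ)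
  simpa [mul_comm] using h

lemma integral_sum (ha : IsCircularGaussian a C μ) (z : ι → ℂ) :
    ∫ ω, ∑ i, a i ω * z i ∂μ = 0 := by
  have := ha.gaussian.isProbabilityMeasure
  rw [integral_finsetSum _ fun i _ => ((ha.memLp i).integrable one_le_two).mul_const _]
  simp [integral_mul_const, ha.mean]

lemma integral_sum_mul_sum (ha : IsCircularGaussian a C μ) (z : ι → ℂ) :
    ∫ ω, (∑ i, a i ω * z i) * (∑ i, a i ω * z i) ∂μ = 0 := by
  have e : ∀ ω, (∑ i, a i ω * z i) * (∑ i, a i ω * z i) =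
      ∑ i, ∑ j, a i ω * a j ω * (z i * z j) := fun ω => by
    rw [Finset.sum_mul_sum]
    exact Finset.sum_congr rfl fun i _ => Finset.sum_congr rfl fun j _ => by ring
  have hi : ∀ i j, Integrable (fun ω => a i ω * a j ω * (z i * z j)) μ := fun i j =>
    ((ha.memLp i).integrable_mul (ha.memLp j)).mul_const _
  simp only [e]
  rw [integral_finsetSum _ fun i _ => integrable_finsetSum _ fun j _ => hi i j]
  refine Finset.sum_eq_zero fun i _ => ?_
  rw [integral_finsetSum _ fun j _ => hi i j]
  refine Finset.sum_eq_zero fun j _ => ?_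
  rw [integral_mul_const, ha.pseudoCovariance, zero_mul]

lemma integral_sum_mul_conj_sum (ha : IsCircularGaussian a C μ) (z : ι → ℂ) :
    ∫ ω, (∑ i, a i ω * z i) * (starRingEnd ℂ) (∑ i, a i ω * z i) ∂μ =
      ∑ i, ∑ j, C i j * (z i * (starRingEnd ℂ) (z j)) := by
  have e : ∀ ω, (∑ i, a i ω * z i) * (starRingEnd ℂ) (∑ i, a i ω * z i) =
      ∑ i, ∑ j, a i ω * (starRingEnd ℂ) (a j ω) * (z i * (starRingEnd ℂ) (z j)) := fun ω => by
    rw [map_sum, Finset.sum_mul_sum]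
    refine Finset.sum_congr rfl fun i _ => Finset.sum_congr rfl fun j _ => ?_
    rw [map_mul]
    ring
  have hi : ∀ i j, Integrable
      (fun ω => a i ω * (starRingEnd ℂ) (a j ω) * (z i * (starRingEnd ℂ) (z j))) μ := fun i j =>
    ((ha.memLp i).integrable_mul (ha.memLp j).star).mul_const _
  simp only [e]
  rw [integral_finsetSum _ fun i _ => integrable_finsetSum _ fun j _ => hi i j]
  refine Finset.sum_congr rfl fun i _ => ?_
  rw [integral_finsetSum _ fun j _ => hi i j]
  refine Finset.sum_congr rfl fun j _ => ?_
  rw [integral_mul_const, ha.covariance]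

end IsCircularGaussian

end Gaussian

/-! ### The DFT and the count of frequencies in the band -/

/-- The quadratic form of the input covariance matrix is diagonal in the frequency domain. -/
lemma inputCovariance_quadratic_form (M : ℕ) (S : ℝ → ℝ) (z : ZMod (2 * M + 1) → ℂ) :
    ∑ i, ∑ j, inputCovariance M S i j * (z i * (starRingEnd ℂ) (z j)) =
      ((∑ k : ZMod (2 * M + 1), S ((k.valMinAbs : ℝ) / ((2 * M + 1 : ℕ) : ℝ)) *
        ‖∑ r, dftMatrix M r k * z r‖ ^ 2 : ℝ) : ℂ) := by
  have e : ∀ i j, inputCovariance M S i j = ∑ k, dftMatrix M i k *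
      ((S ((k.valMinAbs : ℝ) / ((2 * M + 1 : ℕ) : ℝ)) : ℝ) : ℂ) *
        (starRingEnd ℂ) (dftMatrix M j k) := fun i j => by
    rw [inputCovariance, Matrix.mul_apply]
    refine Finset.sum_congr rfl fun k _ => ?_
    rw [Matrix.mul_diagonal, Matrix.conjTranspose_apply]
    rfl
  simp only [e, Finset.sum_mul]
  rw [Finset.sum_congr rfl fun i _ => Finset.sum_comm, Finset.sum_comm, Complex.ofReal_sum]
  refine Finset.sum_congr rfl fun k _ => ?_
  rw [Complex.ofReal_mul, Complex.ofReal_pow, ← Complex.mul_conj', map_sum, Finset.sum_mul_sum,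
    Finset.mul_sum]
  refine Finset.sum_congr rfl fun i _ => ?_
  rw [Finset.mul_sum]
  refine Finset.sum_congr rfl fun j _ => ?_
  rw [map_mul]
  ring

/-- A sum over the integers weighted by a periodic sequence is a finite sum over the residues. -/
lemma tsum_periodic_mul {N : ℕ} [NeZero N] {u : ℤ → ℂ} (hu : Summable u) (b : ZMod N → ℂ) :
    ∑' m : ℤ, b m * u m = ∑ r, b r * ∑' m : ℤ, if (m : ZMod N) = r then u m else 0 := by
  have hs : ∀ r : ZMod N, Summable fun m : ℤ => if (m : ZMod N) = r then u m else 0 := fun r =>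
    (hu.indicator {m : ℤ | (m : ZMod N) = r}).congr fun m => by
      simp [Set.indicator_apply]
  simp only [← tsum_mul_left]
  rw [← Summable.tsum_finsetSum fun r _ => (hs r).mul_left _]
  refine tsum_congr fun m => ?_
  simp

/-- Replacing the balanced residue of `m` by `m` changes the exponent by a multiple of `2 π i`. The
frequency index `k` stays balanced, so `k / N` lies in `[-1/2, 1/2]`. -/
lemma dftMatrix_intCast (M : ℕ) (m : ℤ) (k : ZMod (2 * M + 1)) :
    dftMatrix M m k = (1 / Real.sqrt ((2 * M + 1 : ℕ) : ℝ) : ℂ) *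
      Complex.exp (-(2 * Real.pi * Complex.I * m *
        (((k.valMinAbs : ℝ) / ((2 * M + 1 : ℕ) : ℝ) : ℝ) : ℂ))) := by
  rw [dftMatrix]
  congr 1
  obtain ⟨l, hl⟩ : ((2 * M + 1 : ℕ) : ℤ) ∣ m - (m : ZMod (2 * M + 1)).valMinAbs := by
    rw [← ZMod.intCast_zmod_eq_zero_iff_dvd, Int.cast_sub, ZMod.coe_valMinAbs, sub_self]
  have hm : (m : ℂ) = ((2 * M + 1 : ℕ) : ℂ) * l + ((m : ZMod (2 * M + 1)).valMinAbs : ℂ) := by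
    have : m = ((2 * M + 1 : ℕ) : ℤ) * l + (m : ZMod (2 * M + 1)).valMinAbs := by linarith
    exact_mod_cast this
  rw [hm, Complex.exp_eq_exp_iff_exists_int]
  have hN : ((2 * M + 1 : ℕ) : ℂ) ≠ 0 := Nat.cast_ne_zero.2 (by omega)
  refine ⟨l * k.valMinAbs, ?_⟩
  rw [Complex.ofReal_div, Complex.ofReal_intCast, Complex.ofReal_natCast, Int.cast_mul]
  generalize ((2 * M + 1 : ℕ) : ℂ) = N at *
  field_simp
  ring

/-- Number of the frequencies `i / N`, where `N = 2 M + 1`, that fall into the band `|f| < w`. -/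
lemma card_band {w : ℝ} (hw : 0 < w) (hw2 : w < 1 / 2) (M : ℕ) :
    ((Finset.univ.filter fun k : ZMod (2 * M + 1) =>
      |(k.valMinAbs : ℝ) / ((2 * M + 1 : ℕ) : ℝ)| < w).card : ℝ) =
        2 * ⌈w * ((2 * M + 1 : ℕ) : ℝ)⌉₊ - 1 := by
  set N := 2 * M + 1 with hN
  have hN0 : (0 : ℝ) < (N : ℝ) := by positivity
  have hmem : ∀ j : ℤ, |(j : ℝ) / (N : ℝ)| < w ↔ j ∈ Finset.Ioo (-⌈w * (N : ℝ)⌉) ⌈w * (N : ℝ)⌉ := by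
    intro j
    rw [abs_div, abs_of_pos hN0, div_lt_iff₀ hN0, abs_lt, Finset.mem_Ioo, Int.lt_ceil, neg_lt,
      ← Int.cast_neg, ← Int.lt_ceil, neg_lt]
  -- As `w < 1/2`, each integer `j` with `|j| < w N` is its own balanced residue modulo `N`.
  have hval : ∀ j ∈ Finset.Ioo (-⌈w * (N : ℝ)⌉) ⌈w * (N : ℝ)⌉, (j : ZMod N).valMinAbs = j := by
    intro j hj
    have h := (hmem j).2 hj
    rw [abs_div, abs_of_pos hN0, div_lt_iff₀ hN0, abs_lt] at h
    have h1 : w * (N : ℝ) < 1 / 2 * (N : ℝ) := mul_lt_mul_of_pos_right hw2 hN0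
    refine (ZMod.valMinAbs_spec _ _).2 ⟨rfl, ?_, ?_⟩
    · have : -(N : ℝ) < (j : ℝ) * 2 := by linarith [h.1]
      exact_mod_cast this
    · have : (j : ℝ) * 2 ≤ (N : ℝ) := by linarith [h.2]
      exact_mod_cast this
  have hcard : (Finset.univ.filter fun k : ZMod N => |(k.valMinAbs : ℝ) / (N : ℝ)| < w).card =
      (Finset.Ioo (-⌈w * (N : ℝ)⌉) ⌈w * (N : ℝ)⌉).card := by
    refine Finset.card_nbij' (fun k => k.valMinAbs) (fun j => (j : ZMod N)) ?_ ?_ ?_ ?_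
    · intro k hk
      exact (hmem _).1 (Finset.mem_filter.1 hk).2
    · intro j hj
      refine Finset.mem_filter.2 ⟨Finset.mem_univ _, ?_⟩
      rw [hval j hj]
      exact (hmem j).2 hj
    · intro k _
      exact ZMod.coe_valMinAbs k
    · exact hval
  have hpos : 0 < ⌈w * (N : ℝ)⌉ := Int.ceil_pos.2 (by positivity)
  rw [hcard, Int.card_Ioo]
  have e := natCast_ceil_eq_intCast_ceil (a := w * (N : ℝ)) (by positivity)
  rw [e, ← Int.cast_natCast, Int.toNat_of_nonneg (by omega)]
  push_cast
  ring

lemma tendsto_card_band {w : ℝ} (hw : 0 < w) (hw2 : w < 1 / 2) :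
    Tendsto (fun M : ℕ => ((Finset.univ.filter fun k : ZMod (2 * M + 1) =>
      |(k.valMinAbs : ℝ) / ((2 * M + 1 : ℕ) : ℝ)| < w).card : ℝ) / ((2 * M + 1 : ℕ) : ℝ))
      atTop (𝓝 (2 * w)) := by
  simp only [card_band hw hw2]
  have hN : Tendsto (fun M : ℕ => ((2 * M + 1 : ℕ) : ℝ)) atTop atTop :=
    tendsto_natCast_atTop_atTop.comp
      (tendsto_atTop_mono (fun M => (by omega : M ≤ 2 * M + 1)) tendsto_id)
  have h := ((tendsto_nat_ceil_mul_div_atTop hw.le).comp hN).const_mul 2 |>.sub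
    (tendsto_inv_atTop_zero.comp hN)
  rw [sub_zero] at h
  refine h.congr fun M => ?_
  simp only [Function.comp_apply]
  ring

/-- Power of the transmitted signal for a block of `2 M + 1` symbols. -/
noncomputable def blockPower (β δ P : ℝ) (M : ℕ) : ℝ :=
  P / (δ * (1 + β)) * (((Finset.univ.filter fun k : ZMod (2 * M + 1) =>
    |(k.valMinAbs : ℝ) / ((2 * M + 1 : ℕ) : ℝ)| < δ * (1 + β) / 2).card : ℝ) /
      ((2 * M + 1 : ℕ) : ℝ))

/-- Frequency zero is always in the band, so the Gaussian at each time is nondegenerate for every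
block length. -/
lemma blockPower_pos {β δ P : ℝ} (hβ : 0 < β) (hδ : 0 < δ) (hP : 0 < P) (M : ℕ) :
    0 < blockPower β δ P M := by
  have hcard : 0 < (Finset.univ.filter fun k : ZMod (2 * M + 1) =>
      |(k.valMinAbs : ℝ) / ((2 * M + 1 : ℕ) : ℝ)| < δ * (1 + β) / 2).card := by
    refine Finset.card_pos.2 ⟨0, Finset.mem_filter.2 ⟨Finset.mem_univ _, ?_⟩⟩
    rw [ZMod.valMinAbs_zero]
    simp only [Int.cast_zero, zero_div, abs_zero]
    positivity
  rw [blockPower]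
  positivity

lemma tendsto_blockPower {β δ P : ℝ} (hβ : 0 < β) (hδ : δ ∈ Set.Ioo (0 : ℝ) (1 / (1 + β))) :
    Tendsto (blockPower β δ P) atTop (𝓝 P) := by
  have hδ0 := hδ.1
  have h := (tendsto_card_band (w := δ * (1 + β) / 2) (by positivity)
    (IsPulse.half_band_lt hβ hδ)).const_mul (P / (δ * (1 + β)))
  have e : P / (δ * (1 + β)) * (2 * (δ * (1 + β) / 2)) = P := by field_simp
  rw [e] at h
  exact h

lemma abs_valMinAbs_div_le (M : ℕ) (k : ZMod (2 * M + 1)) :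
    |(k.valMinAbs : ℝ) / ((2 * M + 1 : ℕ) : ℝ)| ≤ 1 / 2 := by
  have hN0 : (0 : ℝ) < ((2 * M + 1 : ℕ) : ℝ) := by positivity
  have h := k.valMinAbs_mem_Ioc
  have h1 : (-((2 * M + 1 : ℕ) : ℝ)) < (k.valMinAbs : ℝ) * 2 := by exact_mod_cast h.1
  have h2 : (k.valMinAbs : ℝ) * 2 ≤ ((2 * M + 1 : ℕ) : ℝ) := by exact_mod_cast h.2
  rw [abs_div, abs_of_pos hN0, div_le_iff₀ hN0, abs_le]
  constructor <;> linarith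

/-! ### Distribution of the transmitted power -/

namespace IsPulse

variable {p : ℝ → ℝ} {T β δ : ℝ}

/-- The spectrum of one period of the transmitted signal, at every time. -/
lemma norm_sq_dft_samples (hp : IsPulse p T β) (hT : 0 < T) (hβ : 0 < β)
    (hδ : δ ∈ Set.Ioo (0 : ℝ) (1 / (1 + β))) (M : ℕ) (t : ℝ) (k : ZMod (2 * M + 1)) :
    ‖∑ r, dftMatrix M r k *
        ∑' m : ℤ, if (m : ZMod (2 * M + 1)) = r then (p (t - m * (δ * T)) : ℂ) else 0‖ ^ 2 =
      1 / ((2 * M + 1 : ℕ) : ℝ) * (1 / (δ * T) *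
        generatingFunction p (δ * T) ((k.valMinAbs : ℝ) / ((2 * M + 1 : ℕ) : ℝ))) := by
  have hh : 0 < δ * T := mul_pos hδ.1 hT
  -- Unfolding the residues turns the DFT of the periodized samples into the discrete-time spectrum
  -- at `k / N`.
  rw [← tsum_periodic_mul (hp.summable_norm_samples hh t).of_norm (fun r => dftMatrix M r k),
    tsum_congr fun m : ℤ => by rw [dftMatrix_intCast, mul_assoc], tsum_mul_left, norm_mul, mul_pow,
    hp.norm_sq_tsum_samples hh (nyquist_rate hT hβ hδ) t (abs_valMinAbs_div_le M k)]
  congr 1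
  rw [norm_div, norm_one, Complex.norm_real, Real.norm_of_nonneg (Real.sqrt_nonneg _), div_pow,
    one_pow, Real.sq_sqrt (by positivity)]

/-- For an optimal power allocation the transmitted signal has, at every time, an exponentially
distributed power. -/
lemma ccdf_signal (hp : IsPulse p T β) (hT : 0 < T) (hβ : 0 < β)
    (hδ : δ ∈ Set.Ioo (0 : ℝ) (1 / (1 + β))) {P : ℝ} (hP : 0 < P) {c : ℂ} (hc : c ≠ 0) {σ₀ : ℝ}
    (hσ₀ : 0 < σ₀) {S : ℝ → ℝ} (hS : IsOptimal p (δ * T) c σ₀ P S) {Ω : Type*} [MeasurableSpace Ω]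
    {μ : Measure Ω} {M : ℕ} {a : ZMod (2 * M + 1) → Ω → ℂ}
    (ha : IsCircularGaussian a (inputCovariance M S) μ) {γ : ℝ} (hγ : 0 ≤ γ) (t : ℝ) :
    ccdf μ (signal p (δ * T) M a) γ t = Real.exp (-(γ / blockPower β δ P M)) := by
  have hh : 0 < δ * T := mul_pos hδ.1 hT
  set z : ZMod (2 * M + 1) → ℂ := fun r =>
    ∑' m : ℤ, if (m : ZMod (2 * M + 1)) = r then (p (t - m * (δ * T)) : ℂ) else 0 with hz
  have hsig : ∀ ω, signal p (δ * T) M a t ω = ∑ r, a r ω * z r := fun ω =>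
    tsum_periodic_mul (hp.summable_norm_samples hh t).of_norm (fun r => a r ω)
  -- Each summand is `(S 𝒢)(k / N) / (N h)`, constant on the band and zero off it, so the variance
  -- reduces to a count.
  have hvar : (∑ k : ZMod (2 * M + 1), S ((k.valMinAbs : ℝ) / ((2 * M + 1 : ℕ) : ℝ)) *
      ‖∑ r, dftMatrix M r k * z r‖ ^ 2) = blockPower β δ P M := by
    have e : ∀ k : ZMod (2 * M + 1), S ((k.valMinAbs : ℝ) / ((2 * M + 1 : ℕ) : ℝ)) *
        ‖∑ r, dftMatrix M r k * z r‖ ^ 2 = 1 / ((2 * M + 1 : ℕ) : ℝ) * (1 / (δ * T)) *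
          if |(k.valMinAbs : ℝ) / ((2 * M + 1 : ℕ) : ℝ)| < δ * (1 + β) / 2
            then P * T / (1 + β) else 0 := fun k => by
      rw [hp.norm_sq_dft_samples hT hβ hδ, ← hp.mul_eq_of_isOptimal hT hβ hδ hP.le hc hσ₀ hS
        (abs_valMinAbs_div_le M k)]
      ring
    rw [Finset.sum_congr rfl fun k _ => e k, ← Finset.mul_sum, ← Finset.sum_filter,
      Finset.sum_const, nsmul_eq_mul, blockPower]
    have := hδ.1.ne'
    generalize (Finset.card _ : ℝ) = n
    field_simp
  rw [ccdf]
  simp only [hsig]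
  refine measureReal_le_norm_sq (ha.hasGaussianLaw_sum z) (ha.integral_sum z)
    (blockPower_pos hβ hδ.1 hP M) ?_ (ha.integral_sum_mul_sum z) hγ
  rw [ha.integral_sum_mul_conj_sum, inputCovariance_quadratic_form, hvar]

lemma averageCCDF_signal (hp : IsPulse p T β) (hT : 0 < T) (hβ : 0 < β)
    (hδ : δ ∈ Set.Ioo (0 : ℝ) (1 / (1 + β))) {P : ℝ} (hP : 0 < P) {c : ℂ} (hc : c ≠ 0) {σ₀ : ℝ}
    (hσ₀ : 0 < σ₀) {S : ℝ → ℝ} (hS : IsOptimal p (δ * T) c σ₀ P S) {Ω : Type*} [MeasurableSpace Ω]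
    {μ : Measure Ω} {M : ℕ} {a : ZMod (2 * M + 1) → Ω → ℂ}
    (ha : IsCircularGaussian a (inputCovariance M S) μ) {γ : ℝ} (hγ : 0 ≤ γ) :
    averageCCDF μ (signal p (δ * T) M a) (δ * T) γ = Real.exp (-(γ / blockPower β δ P M)) := by
  have hh : 0 < δ * T := mul_pos hδ.1 hT
  rw [averageCCDF]
  simp only [hp.ccdf_signal hT hβ hδ hP hc hσ₀ hS ha hγ]
  rw [intervalIntegral.integral_const, smul_eq_mul, sub_zero, ← mul_assoc,
    one_div_mul_cancel hh.ne', one_mul]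

end IsPulse

/-- The instantaneous power is nonnegative: negative levels are exceeded with probability one. -/
lemma averageCCDF_of_neg {Ω : Type*} [MeasurableSpace Ω] (μ : Measure Ω) [IsProbabilityMeasure μ]
    (x : ℝ → Ω → ℂ) {h : ℝ} (hh : 0 < h) {γ : ℝ} (hγ : γ < 0) : averageCCDF μ x h γ = 1 := by
  have e : ∀ t, ccdf μ x γ t = 1 := fun t => by
    have : {ω | γ ≤ ‖x t ω‖ ^ 2} = Set.univ :=
      Set.eq_univ_of_forall fun ω => hγ.le.trans (by positivity)
    rw [ccdf, this, probReal_univ]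
  rw [averageCCDF]
  simp only [e]
  rw [intervalIntegral.integral_const, smul_eq_mul, sub_zero]
  field_simp

lemma tendsto_exp_neg_level (γ T E : ℝ) :
    Tendsto (fun δ : ℝ => Real.exp (-(γ * δ * T / E))) (𝓝[>] 0) (𝓝 1) := by
  have h : Continuous fun δ : ℝ => Real.exp (-(γ * δ * T / E)) := by fun_prop
  have h0 : Tendsto (fun δ : ℝ => Real.exp (-(γ * δ * T / E))) (𝓝[>] 0) _ :=
    (h.tendsto 0).mono_left nhdsWithin_le_nhds
  simpa using h0

end FTN

/-! ### Limits in the block length and in the acceleration factor -/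

theorem mainTheorem3
    -- the pulse, the Nyquist period and the roll-off factor
    (p : ℝ → ℝ) (T β : ℝ) (hT : 0 < T) (hβ : 0 < β) (hp : FTN.IsPulse p T β)
    -- the channel coefficient, the noise level and the symbol energy
    (c : ℂ) (hc : c ≠ 0) (σ₀ : ℝ) (hσ₀ : 0 < σ₀) (E : ℝ) (hE : 0 < E)
    -- the transmit power as a function of `δ`: the received SNR does not depend on `δ`
    (P : ℝ → ℝ)
    (hP : ∀ δ ∈ Set.Ioo (0 : ℝ) (1 / (1 + β)), FTN.receivedSNR (P δ) δ σ₀ = (E / T) / σ₀ ^ 2) :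
    (∀ δ ∈ Set.Ioo (0 : ℝ) (1 / (1 + β)),
      FTN.IsOptimal p (δ * T) c σ₀ (P δ) (FTN.inverseSpectrum p T β δ (P δ))) ∧
    ∀ (S : ℝ → ℝ → ℝ),
      -- optimal power allocation
      (∀ δ ∈ Set.Ioo (0 : ℝ) (1 / (1 + β)), FTN.IsOptimal p (δ * T) c σ₀ (P δ) (S δ)) →
      ∀ {Ω : Type*} [MeasurableSpace Ω] (μ : Measure Ω) [IsProbabilityMeasure μ]
        (a : ℝ → (M : ℕ) → ZMod (2 * M + 1) → Ω → ℂ),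
      -- Gaussian symbols
      (∀ δ ∈ Set.Ioo (0 : ℝ) (1 / (1 + β)), ∀ M : ℕ,
        FTN.IsCircularGaussian (a δ M) (FTN.inputCovariance M (S δ)) μ) →
      -- the average CCDF for large `N = 2 M + 1`
      (∀ δ ∈ Set.Ioo (0 : ℝ) (1 / (1 + β)), ∀ γ : ℝ, 0 ≤ γ →
        Tendsto
          (fun M : ℕ => FTN.averageCCDF μ (FTN.signal p (δ * T) M (a δ M)) (δ * T) γ)
          atTop (𝓝 (Real.exp (-(γ * δ * T / E))))) ∧
      -- it converges to `1` as `δ` approaches zero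
      (∀ γ : ℝ, 0 ≤ γ →
        Tendsto
          (fun δ : ℝ => limUnder atTop (fun M : ℕ =>
            FTN.averageCCDF μ (FTN.signal p (δ * T) M (a δ M)) (δ * T) γ))
          (𝓝[>] 0) (𝓝 1)) ∧
      -- the power becomes unbounded: any level is exceeded with probability close to one
      (∀ γ η : ℝ, η < 1 → ∀ᶠ δ in 𝓝[>] (0 : ℝ), ∀ᶠ M : ℕ in atTop,
        η < FTN.averageCCDF μ (FTN.signal p (δ * T) M (a δ M)) (δ * T) γ) := by
  have hmem : ∀ᶠ δ in 𝓝[>] (0 : ℝ), δ ∈ Set.Ioo (0 : ℝ) (1 / (1 + β)) :=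
    Ioo_mem_nhdsGT (by positivity)
  have hPE : ∀ δ ∈ Set.Ioo (0 : ℝ) (1 / (1 + β)), P δ = E / (δ * T) := fun δ hδ => by
    have h := hP δ hδ
    have hδ0 := hδ.1.ne'
    rw [FTN.receivedSNR, div_left_inj' (by positivity), eq_div_iff hT.ne'] at h
    rw [eq_div_iff (by positivity)]
    linarith
  have hPpos : ∀ δ ∈ Set.Ioo (0 : ℝ) (1 / (1 + β)), 0 < P δ := fun δ hδ => by
    rw [hPE δ hδ]
    exact div_pos hE (mul_pos hδ.1 hT)
  refine ⟨fun δ hδ => hp.isOptimal_inverseSpectrum hT hβ hδ (hPpos δ hδ).le hc hσ₀, ?_⟩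
  intro S hS Ω _ μ _ a ha
  have hlim : ∀ δ ∈ Set.Ioo (0 : ℝ) (1 / (1 + β)), ∀ γ : ℝ, 0 ≤ γ →
      Tendsto (fun M : ℕ => FTN.averageCCDF μ (FTN.signal p (δ * T) M (a δ M)) (δ * T) γ)
        atTop (𝓝 (Real.exp (-(γ * δ * T / E)))) := by
    intro δ hδ γ hγ
    simp only [fun M => hp.averageCCDF_signal hT hβ hδ (hPpos δ hδ) hc hσ₀ (hS δ hδ) (ha δ hδ M) hγ]
    have e : γ * δ * T / E = γ / P δ := by
      have hδ0 := hδ.1.ne'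
      rw [hPE δ hδ]
      field_simp
    rw [e]
    exact (Real.continuous_exp.tendsto _).comp
      ((tendsto_const_nhds.div (FTN.tendsto_blockPower hβ hδ) (hPpos δ hδ).ne').neg)
  refine ⟨hlim, fun γ hγ => ?_, fun γ η hη => ?_⟩
  -- The inner limit is known to be the exponential only for `δ` in the admissible interval, which
  -- suffices near `0⁺`.
  · refine (FTN.tendsto_exp_neg_level γ T E).congr' ?_
    filter_upwards [hmem] with δ hδ
    exact (hlim δ hδ γ hγ).limUnder_eq.symm
  -- The exponential formula covers only `γ ≥ 0`; negative levels are exceeded surely.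
  · rcases lt_or_ge γ 0 with hγ | hγ
    · filter_upwards [hmem] with δ hδ
      refine Eventually.of_forall fun M => ?_
      rwa [FTN.averageCCDF_of_neg μ _ (mul_pos hδ.1 hT) hγ]
    · filter_upwards [hmem, (FTN.tendsto_exp_neg_level γ T E).eventually (lt_mem_nhds hη)]
        with δ hδ hlt
      exact (hlim δ hδ γ hγ).eventually (lt_mem_nhds hlt)
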